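/- Let $n\ge 2$, let $\omega\subset\mathbb{R}^{n-1}$ be a bounded domain (non-empty, open, connected; for instance one with Lipschitz boundary) and let $H\in C(\overline\omega)$ be real-valued. For an open set $G$ and a part $S$ of its boundary let $\mathring H^1(G;S)$ be the space of real functions in $H^1(G)$ that vanish on $S$, i.e. the closure in $H^1(G)$ of the restrictions to $G$ of the functions in $C_c^\infty(\mathbb{R}^m)$ that vanish near $\overline S$ (where $G\subset\mathbb{R}^m$). A number $\Lambda\in\mathbb{R}$ is an eigenvalue, with eigenfunction $U$, of the problem in $G$ with Dirichlet condition on $S$ and Neumann condition on the rest of the boundary if $U\in\mathring H^1(G;S)$, $U\not\equiv0$, and $$(\nabla U,\nabla V)_{L^2(G)}=\Lambda\,(U,V)_{L^2(G)}\qquad\text{for all } V\in\mathring H^1(G;S).$$ Let $\mu_1$ be the smallest eigenvalue, and $\varphi_1$ a corresponding eigenfunction, of the Dirichlet problem in $\omega$ (the case $G=\omega$, $S=\partial\omega$), and suppose that $$\int_\omega H(\eta)\left(|\nabla_\eta\varphi_1(\eta)|^2-\mu_1\varphi_1(\eta)^2\right)d\eta<0 .$$ Let $$\Pi=\{(\eta,\zeta)\in\mathbb{R}^{n-1}\times\mathbb{R}:\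 \eta\in\omega,\ \zeta>-H(\eta)\},\quad \Gamma=\{(\eta,\zeta):\ \eta\in\omega,\ \zeta=-H(\eta)\},\quad \Sigma=\partial\Pi\setminus\overline\Gamma .$$ Then the mixed boundary value problem in the semi-infinite cylinder $\Pi$ (Dirichlet condition on the lateral side $\Sigma$, Neumann condition on the curved end $\Gamma$) has an eigenvalue $\Lambda$ with $0<\Lambda<\mu_1$ (here $\mu_1$ is the well-known cut-off of the continuous spectrum of the problem). -/

import Mathlib

open MeasureTheory Set
open scoped InnerProductSpace ENNReal

namespace MixedBVP

section Sobolev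

variable {E : Type*} [NormedAddCommGroup E] [InnerProductSpace ℝ E] [CompleteSpace E]
  [MeasureSpace E]

/-- The vector field `g` is the weak gradient of `u` in the open set `Ω`:
`∫_Ω u ∇ψ = - ∫_Ω ψ g` for all test functions `ψ ∈ C_c^∞(Ω)`. -/
def HasWeakGradient (Ω : Set E) (u : E → ℝ) (g : E → E) : Prop :=
  ∀ ψ : E → ℝ, ContDiff ℝ (⊤ : ℕ∞) ψ → HasCompactSupport ψ → tsupport ψ ⊆ Ω →
    ∫ x in Ω, u x • gradient ψ x = -∫ x in Ω, ψ x • g x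

/-- `u` belongs to the Sobolev space `H¹(Ω)` and `g` is its weak gradient. -/
structure MemH1 (Ω : Set E) (u : E → ℝ) (g : E → E) : Prop where
  memLp_fun : MemLp u 2 (volume.restrict Ω)
  memLp_grad : MemLp g 2 (volume.restrict Ω)
  weakGradient : HasWeakGradient Ω u g

/-- `u` belongs to `H̊¹(Ω; S)`, the space of functions in `H¹(Ω)` that vanish on the part `S` of
the boundary, and `g` is the weak gradient of `u`. The space is the closure in the norm of `H¹(Ω)`
of the (restrictions to `Ω` of) smooth compactly supported functions on the whole space that vanish
in a neighbourhood of the closure of `S`. No condition is imposed on the rest of the boundary. -/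
structure MemH1Zero (Ω S : Set E) (u : E → ℝ) (g : E → E) : Prop extends MemH1 Ω u g where
  approx : ∀ ε : ℝ≥0∞, 0 < ε → ∃ v : E → ℝ,
    ContDiff ℝ (⊤ : ℕ∞) v ∧ HasCompactSupport v ∧ Disjoint (tsupport v) (closure S) ∧
    eLpNorm (fun x => v x - u x) 2 (volume.restrict Ω) ≤ ε ∧
    eLpNorm (fun x => gradient v x - g x) 2 (volume.restrict Ω) ≤ ε

/-- `(Λ, u)` is an eigenpair (and `g` is the weak gradient of `u`) of the variational problem
`(∇u, ∇v)_Ω = Λ (u, v)_Ω` for all `v ∈ H̊¹(Ω; S)`, with `u ∈ H̊¹(Ω; S)`, `u ≢ 0`. This is the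
spectral problem for `-Δ` with the Dirichlet condition on `S` and the (natural) Neumann condition
on the rest of the boundary. -/
structure IsEigenpair (Ω S : Set E) (Λ : ℝ) (u : E → ℝ) (g : E → E) : Prop where
  mem : MemH1Zero Ω S u g
  ne_zero : ¬ u =ᵐ[volume.restrict Ω] 0
  identity : ∀ (v : E → ℝ) (k : E → E), MemH1Zero Ω S v k →
    ∫ x in Ω, ⟪g x, k x⟫_ℝ = Λ * ∫ x in Ω, u x * v x

/-- `Λ` is an eigenvalue of the problem described in `IsEigenpair`. -/
def IsEigenvalue (Ω S : Set E) (Λ : ℝ) : Prop :=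
  ∃ (u : E → ℝ) (g : E → E), IsEigenpair Ω S Λ u g

/-- `(μ, φ)` is a first eigenpair (and `g` is the weak gradient of `φ`) of the Dirichlet problem
in `ω`: an eigenpair whose eigenvalue is the smallest one. -/
structure IsFirstDirichletEigenpair (ω : Set E) (μ : ℝ) (φ : E → ℝ) (g : E → E) : Prop where
  eigenpair : IsEigenpair ω (frontier ω) μ φ g
  least : ∀ μ' : ℝ, IsEigenvalue ω (frontier ω) μ' → μ ≤ μ'

end Sobolev

section Cylinder

/-- The space `ℝ^d × ℝ` of points `ξ = (η, ζ)` with its Euclidean norm (and Lebesgue measure). -/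
abbrev CylSpace (d : ℕ) : Type := WithLp 2 (EuclideanSpace ℝ (Fin d) × ℝ)

variable {d : ℕ} (ω : Set (EuclideanSpace ℝ (Fin d))) (H : EuclideanSpace ℝ (Fin d) → ℝ)

/-- The semi-infinite cylinder `Π = {(η, ζ) : η ∈ ω, ζ > -H(η)}`. -/
def semiCylinder : Set (CylSpace d) := {ξ | ξ.fst ∈ ω ∧ -H ξ.fst < ξ.snd}

/-- The curved end `Γ = {(η, ζ) : η ∈ ω, ζ = -H(η)}`. -/
def curvedEnd : Set (CylSpace d) := {ξ | ξ.fst ∈ ω ∧ ξ.snd = -H ξ.fst}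

/-- The lateral side `Σ = ∂Π \ closure Γ`. -/
def lateralSide : Set (CylSpace d) := frontier (semiCylinder ω H) \ closure (curvedEnd ω H)

end Cylinder

end MixedBVP

/-!
The eigenvalue is obtained as the minimum of the Rayleigh quotient `∫ |∇v|² / ∫ v²` over
`H̊¹(Π; Σ)`, and everything is done with smooth admissible functions, which are dense by definition.

Attainment. Let `Λ` be the infimum of the Rayleigh quotient, and suppose that for some `m > Λ` the
form `∫ |∇v|² - m ∫ v²` is bounded below by minus a finite sum of squares of `L²` functionals.
Choose a normalized minimizing sequence along which these finitely many functionals converge. By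
the parallelogram law the nonnegative form `∫ |∇v|² - Λ ∫ v²` tends to zero on differences, hence
the sequence is Cauchy in `H¹` and its limit is an eigenfunction (`exists_minimizer`,
`exists_isEigenvalue_lt`). No weak compactness is needed.

Finite rank bounds. A bounded set away from the part of the boundary without Dirichlet condition is
covered by small grid cells, on which functions extended by zero are smooth, and the Poincaré
inequality on convex sets bounds `∫ v²` by the squares of finitely many averages plus a small
multiple of `∫ |∇v|²` (`exists_finite_rank_bound`). In the cross-section `ω` this shows that `μ₁`
bounds the Rayleigh quotients of the Dirichlet problem from below, as otherwise there would be a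
smaller eigenvalue (`IsFirstDirichletEigenpair.rayleigh`). In `Π`, the part above the curved end
is treated slice by slice, with the constant `μ₁`; the remaining bounded part is shifted upwards by
a small `δ`, at the cost of `2 δ² ∫ |∇v|²`, so that it leaves the neighbourhood of the curved end,
whose boundary is only continuous (`exists_finite_rank_bound_semiCylinder`). The same argument with
a large shift gives the Poincaré inequality in `Π` and thus `Λ > 0` (`exists_poincare_const`).

Trial function. Let `χ` be a smooth cutoff function with `χ = 1` on the range of `-H` and with small
`κ = ∫ χ'²`. Then `∫ χ²` over `ζ > -H(η)` equals `H(η) + c` with a constant `c`. For `v(η) χ(ζ)`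
with `v` close to `φ₁`, Fubini's theorem thus bounds the form `∫ |∇(v χ)|² - μ₁ ∫ (v χ)²` by a quantity
close to `∫ H (|∇φ₁|² - μ₁ φ₁²) + κ ∫ φ₁²`, since the constant `c` multiplies
`∫ |∇φ₁|² - μ₁ ∫ φ₁² = 0`. This is negative for small `κ` (`IsEigenpair.exists_trial`).
-/

namespace MixedBVP

/-! ### An abstract minimization principle -/

section Abstract

open Filter Topology

variable {X Y : Type*} [NormedAddCommGroup X] [InnerProductSpace ℝ X]
  [NormedAddCommGroup Y] [InnerProductSpace ℝ Y]

/-- A subsequence along which finitely many bounded scalar sequences are Cauchy. -/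
theorem exists_subseq_sum_inner_sub_sq_lt {κ : Type*} [Fintype κ] (f : κ → X) (x : ℕ → X)
    (R : ℝ)
    (hx : ∀ k, ‖x k‖ ≤ R) :
    ∃ φ : ℕ → ℕ, StrictMono φ ∧ ∀ ε > 0, ∃ N, ∀ j ≥ N, ∀ k ≥ N,
      ∑ i, ⟪f i, x (φ j) - x (φ k)⟫_ℝ ^ 2 < ε := by
  let y : ℕ → EuclideanSpace ℝ κ := fun k => WithLp.toLp 2 (fun i => ⟪f i, x k⟫_ℝ)
  have hy : ∀ j k, ∑ i, ⟪f i, x j - x k⟫_ℝ ^ 2 = ‖y j - y k‖ ^ 2 := by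
    intro j k
    rw [EuclideanSpace.real_norm_sq_eq]
    simp [y, inner_sub_right]
  have hb : Bornology.IsBounded (range y) := by
    rw [isBounded_iff_forall_norm_le]
    refine ⟨Real.sqrt (∑ i, (‖f i‖ * R) ^ 2), ?_⟩
    rintro _ ⟨k, rfl⟩
    rw [EuclideanSpace.norm_eq]
    apply Real.sqrt_le_sqrt
    apply Finset.sum_le_sum
    intro i _
    gcongr
    exact (norm_inner_le_norm _ _).trans (by gcongr; exact hx k)
  obtain ⟨a, -, φ, hφ, hlim⟩ := tendsto_subseq_of_bounded hb (fun n => mem_range_self n)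
  refine ⟨φ, hφ, fun ε hε => ?_⟩
  obtain ⟨N, hN⟩ := Metric.cauchySeq_iff.1 hlim.cauchySeq (Real.sqrt ε) (Real.sqrt_pos.2 hε)
  refine ⟨N, fun j hj k hk => ?_⟩
  rw [hy]
  have := hN j hj k hk
  rw [dist_eq_norm] at this
  exact (Real.lt_sqrt (norm_nonneg _)).1 this

/-- If `Q(w) = ‖w.2‖² - Λ‖w.1‖²` is nonnegative on a subspace and vanishes at `z`, then the
associated bilinear form vanishes at `(z, k)` for all `k`. -/
theorem inner_eq_of_quadratic_nonneg (V : Submodule ℝ (WithLp 2 (X × Y))) (Λ : ℝ)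
    (hV : ∀ w ∈ V, Λ * ‖w.fst‖ ^ 2 ≤ ‖w.snd‖ ^ 2) {z k : WithLp 2 (X × Y)} (hz : z ∈ V)
    (hk : k ∈ V) (hzero : ‖z.snd‖ ^ 2 = Λ * ‖z.fst‖ ^ 2) :
    ⟪z.snd, k.snd⟫_ℝ = Λ * ⟪z.fst, k.fst⟫_ℝ := by
  have key : ∀ t : ℝ, 0 ≤ (‖k.snd‖ ^ 2 - Λ * ‖k.fst‖ ^ 2) * (t * t)
      + (2 * (⟪z.snd, k.snd⟫_ℝ - Λ * ⟪z.fst, k.fst⟫_ℝ)) * t + 0 := by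
    intro t
    have h := hV (z + t • k) (V.add_mem hz (V.smul_mem t hk))
    simp only [WithLp.add_fst, WithLp.add_snd, WithLp.smul_fst, WithLp.smul_snd] at h
    rw [norm_add_sq_real, norm_add_sq_real, norm_smul, norm_smul, inner_smul_right,
      inner_smul_right, mul_pow, mul_pow, Real.norm_eq_abs, sq_abs] at h
    nlinarith
  -- a nonnegative quadratic polynomial without constant term has no linear term
  have := discrim_le_zero key
  rw [discrim] at this
  nlinarith [sq_nonneg (⟪z.snd, k.snd⟫_ℝ - Λ * ⟪z.fst, k.fst⟫_ℝ)]

/-- Existence of a lowest eigenvalue below the threshold `μ`. If the form `‖w.2‖²` is bounded below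
by `m ‖w.1‖²` up to finite rank for each `m < μ`, and drops below `μ ‖w.1‖²` at some point, then
its minimum is attained: by the parallelogram law, a minimizing sequence on which the finite rank
part converges is a Cauchy sequence. -/
theorem exists_minimizer [CompleteSpace X] [CompleteSpace Y]
    (W : Submodule ℝ (WithLp 2 (X × Y))) (μ : ℝ)
    (hlow : ∃ w ∈ W, ‖w.snd‖ ^ 2 < μ * ‖w.fst‖ ^ 2)
    (hfin : ∀ m < μ, ∃ (κ : Type) (_ : Fintype κ) (f : κ → X) (C : ℝ), ∀ w ∈ W,
      m * ‖w.fst‖ ^ 2 ≤ ‖w.snd‖ ^ 2 + C * ∑ i, ⟪f i, w.fst⟫_ℝ ^ 2) :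
    ∃ Λ < μ, (∃ z ∈ W.topologicalClosure, z.fst ≠ 0 ∧ ∀ k ∈ W.topologicalClosure,
      ⟪z.snd, k.snd⟫_ℝ = Λ * ⟪z.fst, k.fst⟫_ℝ) ∧
      ∀ c, (∀ w ∈ W, c * ‖w.fst‖ ^ 2 ≤ ‖w.snd‖ ^ 2) → c ≤ Λ := by
  obtain ⟨w₀, hw₀, hlt⟩ := hlow
  have hw₀pos : 0 < ‖w₀.fst‖ ^ 2 := by
    rcases (sq_nonneg ‖w₀.fst‖).eq_or_lt with h | h
    · rw [← h] at hlt
      nlinarith [sq_nonneg ‖w₀.snd‖]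
    · exact h
  let C : Set ℝ := {c | ∀ w ∈ W, c * ‖w.fst‖ ^ 2 ≤ ‖w.snd‖ ^ 2}
  have hCne : C.Nonempty := ⟨0, fun w _ => by simp⟩
  have hCbd : ∀ c ∈ C, c ≤ ‖w₀.snd‖ ^ 2 / ‖w₀.fst‖ ^ 2 := fun c hc =>
    (le_div_iff₀ hw₀pos).2 (hc w₀ hw₀)
  have hCbdd : BddAbove C := ⟨_, hCbd⟩
  set Λ := sSup C with hΛ
  have hΛμ : Λ < μ := (csSup_le hCne hCbd).trans_lt ((div_lt_iff₀ hw₀pos).2 hlt)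
  have hCcl : IsClosed C := by
    have : C = ⋂ w ∈ W, {c : ℝ | c * ‖w.fst‖ ^ 2 ≤ ‖w.snd‖ ^ 2} := by
      ext c; simp [C]
    rw [this]
    exact isClosed_biInter fun w _ => isClosed_le (by fun_prop) (by fun_prop)
  have hΛC : Λ ∈ C := hCcl.csSup_mem hCne hCbdd
  -- a normalized minimizing sequence
  have hseq : ∀ k : ℕ, ∃ w ∈ W, ‖w.fst‖ = 1 ∧ ‖w.snd‖ ^ 2 < Λ + 1 / ((k : ℝ) + 1) := by
    intro k
    have hn : Λ + 1 / ((k : ℝ) + 1) ∉ C := fun h => by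
      have := le_csSup hCbdd h
      have : 0 < 1 / ((k : ℝ) + 1) := by positivity
      linarith
    simp only [C, mem_ofPred_eq, not_forall, not_le] at hn
    obtain ⟨w, hw, hlt⟩ := hn
    have hpos : 0 < ‖w.fst‖ := by
      rcases (norm_nonneg w.fst).eq_or_lt with h | h
      · rw [← h] at hlt
        nlinarith [sq_nonneg ‖w.snd‖]
      · exact h
    refine ⟨‖w.fst‖⁻¹ • w, W.smul_mem _ hw, ?_, ?_⟩
    · rw [WithLp.smul_fst, norm_smul, norm_inv, norm_norm, inv_mul_cancel₀ hpos.ne']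
    · rw [WithLp.smul_snd, norm_smul, norm_inv, norm_norm, mul_pow, inv_pow, inv_mul_lt_iff₀
        (by positivity)]
      linarith
  choose w hwW hw1 hw2 using hseq
  obtain ⟨m, hΛm, hmμ⟩ := exists_between hΛμ
  obtain ⟨κ, _, f, C, hs⟩ := hfin m hmμ
  obtain ⟨φ, hφ, hsub⟩ := exists_subseq_sum_inner_sub_sq_lt f (fun k => (w k).fst) 1
    (fun k => (hw1 k).le)
  let u : ℕ → WithLp 2 (X × Y) := fun k => w (φ k)
  have huQ : ∀ k, ‖(u k).snd‖ ^ 2 < Λ + 1 / ((k : ℝ) + 1) := fun k => (hw2 (φ k)).trans_le (by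
    have : (k : ℝ) ≤ φ k := by exact_mod_cast hφ.id_le k
    gcongr)
  -- the form is nonnegative at the sum, so the parallelogram law bounds it at the difference
  have hpar : ∀ j k, ‖(u j - u k).snd‖ ^ 2 - Λ * ‖(u j - u k).fst‖ ^ 2 ≤
      2 * (1 / ((j : ℝ) + 1)) + 2 * (1 / ((k : ℝ) + 1)) := by
    intro j k
    have h := hΛC (u j + u k) (W.add_mem (hwW _) (hwW _))
    have h1 := parallelogram_law_with_norm ℝ (u j).fst (u k).fst
    have h2 := parallelogram_law_with_norm ℝ (u j).snd (u k).snd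
    have e1 : ‖(u j).fst‖ = 1 := hw1 _
    have e2 : ‖(u k).fst‖ = 1 := hw1 _
    rw [e1, e2] at h1
    simp only [WithLp.add_fst, WithLp.add_snd, WithLp.sub_fst, WithLp.sub_snd] at h ⊢
    have hj := huQ j
    have hk := huQ k
    have : Λ * (‖(u j).fst + (u k).fst‖ ^ 2 + ‖(u j).fst - (u k).fst‖ ^ 2) = Λ * 4 := by
      congr 1; linarith
    nlinarith
  -- apply the finite rank bound, with a level `m` strictly above `Λ`, to the differences
  have hcauchy : CauchySeq u := by
    rw [Metric.cauchySeq_iff]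
    intro ε hε
    set A : ℝ := (1 + |Λ|) * (1 + |C|) / (m - Λ) with hA
    have hmΛ : 0 < m - Λ := by linarith
    have hA0 : 0 ≤ A := by positivity
    obtain ⟨δ, hδ, hδε⟩ : ∃ δ > 0, (A + 1) * δ ≤ ε ^ 2 :=
      ⟨ε ^ 2 / (A + 1), by positivity, by rw [mul_div_cancel₀]; positivity⟩
    obtain ⟨N₁, hN₁⟩ := hsub δ hδ
    obtain ⟨N₂, hN₂⟩ := exists_nat_one_div_lt (show 0 < δ / 4 by positivity)
    refine ⟨max N₁ N₂, fun j hj k hk => ?_⟩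
    have hsum := hN₁ j (le_of_max_le_left hj) k (le_of_max_le_left hk)
    have bnd : ∀ i : ℕ, i ≥ max N₁ N₂ → 1 / ((i : ℝ) + 1) < δ / 4 := fun i hi => by
      refine lt_of_le_of_lt ?_ hN₂
      have : (N₂ : ℝ) ≤ i := by exact_mod_cast le_of_max_le_right hi
      gcongr
    have hq := hpar j k
    have hm := hs (u j - u k) (W.sub_mem (hwW _) (hwW _))
    have hsum' : ∑ i, ⟪f i, (u j - u k).fst⟫_ℝ ^ 2 < δ := hsum
    have b1 := bnd j hj
    have b2 := bnd k hk
    set a := ‖(u j - u k).fst‖ ^ 2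
    set b := ‖(u j - u k).snd‖ ^ 2
    have ha : 0 ≤ a := by positivity
    have hqδ : b - Λ * a < δ := by linarith
    set σ := ∑ i, ⟪f i, (u j - u k).fst⟫_ℝ ^ 2
    have hσ : 0 ≤ σ := Finset.sum_nonneg fun i _ => sq_nonneg _
    have hCσ : C * σ ≤ |C| * δ := by
      have := le_abs_self C
      gcongr
    have h1 : (m - Λ) * a ≤ (1 + |C|) * δ := by
      have : m * a ≤ b + C * σ := hm
      linarith
    have h2 : (1 + |Λ|) * a ≤ A * δ := by
      rw [hA, div_mul_eq_mul_div, le_div_iff₀ hmΛ]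
      nlinarith [abs_nonneg Λ]
    have h3 : ‖u j - u k‖ ^ 2 < ε ^ 2 := by
      rw [WithLp.prod_norm_sq_eq_of_L2]
      change a + b < ε ^ 2
      nlinarith [le_abs_self Λ]
    rw [dist_eq_norm]
    exact lt_of_pow_lt_pow_left₀ 2 hε.le h3
  obtain ⟨z, hz⟩ := cauchySeq_tendsto_of_complete hcauchy
  have hfst : Continuous (fun x : WithLp 2 (X × Y) => x.fst) := WithLp.continuous_fst _ _ _
  have hsnd : Continuous (fun x : WithLp 2 (X × Y) => x.snd) := WithLp.continuous_snd _ _ _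
  have hzV : z ∈ W.topologicalClosure :=
    mem_closure_of_tendsto hz (Eventually.of_forall fun k => hwW _)
  have hz1 : ‖z.fst‖ = 1 := by
    have h := ((hfst.tendsto z).comp hz).norm
    refine tendsto_nhds_unique h ?_
    have : (fun x => ‖((fun x : WithLp 2 (X × Y) => x.fst) ∘ u) x‖) = fun _ => 1 :=
      funext fun k => hw1 _
    rw [this]; exact tendsto_const_nhds
  have hVcl : ∀ y ∈ W.topologicalClosure, Λ * ‖y.fst‖ ^ 2 ≤ ‖y.snd‖ ^ 2 := by
    intro y hy
    have hcl : IsClosed {y : WithLp 2 (X × Y) | Λ * ‖y.fst‖ ^ 2 ≤ ‖y.snd‖ ^ 2} :=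
      isClosed_le (by fun_prop) (by fun_prop)
    exact closure_minimal (fun w hw => hΛC w hw) hcl hy
  have hz2 : ‖z.snd‖ ^ 2 ≤ Λ := by
    have h := ((hsnd.tendsto z).comp hz).norm.pow 2
    have h' : Tendsto (fun k : ℕ => Λ + 1 / ((k : ℝ) + 1)) atTop (𝓝 (Λ + 0)) :=
      tendsto_const_nhds.add tendsto_one_div_add_atTop_nhds_zero_nat
    rw [add_zero] at h'
    exact le_of_tendsto_of_tendsto' h h' (fun k => (huQ k).le)
  refine ⟨Λ, hΛμ, ⟨z, hzV, ?_, fun k hk => ?_⟩, fun c hc => le_csSup hCbdd hc⟩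
  · intro h
    rw [h, norm_zero] at hz1
    exact zero_ne_one hz1
  · refine inner_eq_of_quadratic_nonneg _ Λ hVcl hzV hk (le_antisymm ?_ (hVcl z hzV))
    rw [hz1]; simpa using hz2

end Abstract

/-! ### The Sobolev space as a closure of pairs and existence of an eigenvalue -/

section Link

set_option linter.unusedSectionVars false

open Filter Topology

variable {E : Type*} [NormedAddCommGroup E] [InnerProductSpace ℝ E]

/-- The admissible functions for the Dirichlet condition on `S`: smooth compactly supported
functions on the whole space vanishing near the closure of `S`. Their restrictions to `Ω` are dense
in `H̊¹(Ω; S)`. -/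
structure IsAdmissible (S : Set E) (v : E → ℝ) : Prop where
  contDiff : ContDiff ℝ (⊤ : ℕ∞) v
  hasCompactSupport : HasCompactSupport v
  disjoint : Disjoint (tsupport v) (closure S)

theorem IsAdmissible.add {S : Set E} {v w : E → ℝ} (hv : IsAdmissible S v)
    (hw : IsAdmissible S w) : IsAdmissible S (v + w) :=
  ⟨hv.contDiff.add hw.contDiff, hv.hasCompactSupport.add hw.hasCompactSupport,
    (hv.disjoint.union_left hw.disjoint).mono_left (tsupport_add v w)⟩

theorem IsAdmissible.const_smul {S : Set E} {v : E → ℝ} (hv : IsAdmissible S v) (c : ℝ) :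
    IsAdmissible S (c • v) :=
  ⟨contDiff_const.smul hv.contDiff, hv.hasCompactSupport.smul_left (f := fun _ => c),
    hv.disjoint.mono_left (closure_mono (Function.support_const_smul_subset c v))⟩

theorem isAdmissible_zero (S : Set E) : IsAdmissible S (0 : E → ℝ) :=
  ⟨contDiff_const, HasCompactSupport.zero, by simp [tsupport]⟩

theorem IsAdmissible.continuous_fderiv {S : Set E} {v : E → ℝ} (hv : IsAdmissible S v) :
    Continuous (fderiv ℝ v) := hv.contDiff.continuous_fderiv (by simp)

theorem IsAdmissible.differentiable {S : Set E} {v : E → ℝ} (hv : IsAdmissible S v) :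
    Differentiable ℝ v := hv.contDiff.differentiable (by simp)

variable [CompleteSpace E]

theorem norm_gradient (v : E → ℝ) (x : E) : ‖gradient v x‖ = ‖fderiv ℝ v x‖ := by
  simp [gradient]

theorem inner_gradient_right (v : E → ℝ) (x e : E) : ⟪e, gradient v x⟫_ℝ = fderiv ℝ v x e := by
  rw [real_inner_comm, gradient, InnerProductSpace.toDual_symm_apply]

theorem IsAdmissible.continuous_gradient {S : Set E} {v : E → ℝ} (hv : IsAdmissible S v) :
    Continuous (gradient v) :=
  (InnerProductSpace.toDual ℝ E).symm.continuous.comp hv.continuous_fderiv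

theorem IsAdmissible.hasCompactSupport_gradient {S : Set E} {v : E → ℝ} (hv : IsAdmissible S v) :
    HasCompactSupport (gradient v) :=
  (hv.hasCompactSupport.fderiv (𝕜 := ℝ)).comp_left (map_zero (InnerProductSpace.toDual ℝ E).symm)

theorem gradient_add' {v w : E → ℝ} (hv : Differentiable ℝ v) (hw : Differentiable ℝ w) :
    gradient (v + w) = gradient v + gradient w := by
  ext1 x
  simp [gradient, fderiv_add (hv x) (hw x)]

theorem gradient_const_smul' {v : E → ℝ} (hv : Differentiable ℝ v) (c : ℝ) :
    gradient (c • v) = c • gradient v := by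
  ext1 x
  simp [gradient, fderiv_const_smul (hv x)]

variable [MeasureSpace E] [BorelSpace E] [FiniteDimensional ℝ E]
  [(volume : Measure E).IsAddHaarMeasure]

theorem IsAdmissible.memLp {S : Set E} {v : E → ℝ} (hv : IsAdmissible S v) (Ω : Set E) :
    MemLp v 2 (volume.restrict Ω) :=
  (hv.contDiff.continuous.memLp_of_hasCompactSupport hv.hasCompactSupport).restrict Ω

theorem IsAdmissible.memLp_gradient {S : Set E} {v : E → ℝ} (hv : IsAdmissible S v) (Ω : Set E) :
    MemLp (gradient v) 2 (volume.restrict Ω) :=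
  (hv.continuous_gradient.memLp_of_hasCompactSupport hv.hasCompactSupport_gradient).restrict Ω

theorem IsAdmissible.integrable_sq {S : Set E} {v : E → ℝ} (hv : IsAdmissible S v) (Ω : Set E) :
    IntegrableOn (fun x => v x ^ 2) Ω := (hv.memLp Ω).integrable_sq

theorem IsAdmissible.integrable_fderiv_sq {S : Set E} {v : E → ℝ} (hv : IsAdmissible S v)
    (Ω : Set E) : IntegrableOn (fun x => ‖fderiv ℝ v x‖ ^ 2) Ω := by
  simpa only [norm_gradient, IntegrableOn] using
    (hv.memLp_gradient Ω).integrable_norm_pow (p := 2) (by norm_num)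

/-- The Hilbert space of pairs (function, vector field) in which `H¹(Ω)` embeds via
`u ↦ (u, ∇u)`. -/
abbrev PairSpace (Ω : Set E) : Type _ :=
  WithLp 2 (Lp ℝ 2 (volume.restrict Ω) × Lp E 2 (volume.restrict Ω))

/-- The subspace of the pairs `(v, ∇v)` with `v` admissible. Its closure is `H̊¹(Ω; S)`. -/
def admissiblePairs (Ω S : Set E) : Submodule ℝ (PairSpace Ω) where
  carrier := {z | ∃ v, IsAdmissible S v ∧ z.fst =ᵐ[volume.restrict Ω] v ∧
    z.snd =ᵐ[volume.restrict Ω] gradient v}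
  add_mem' := by
    rintro z z' ⟨v, hv, h1, h2⟩ ⟨v', hv', h1', h2'⟩
    refine ⟨v + v', hv.add hv', ?_, ?_⟩
    · exact (Lp.coeFn_add _ _).trans (h1.add h1')
    · rw [gradient_add' hv.differentiable hv'.differentiable]
      exact (Lp.coeFn_add _ _).trans (h2.add h2')
  zero_mem' := by
    refine ⟨0, isAdmissible_zero S, Lp.coeFn_zero _ _ _, ?_⟩
    have : gradient (0 : E → ℝ) = 0 := by ext1 x; simp [gradient]
    rw [this]
    exact Lp.coeFn_zero _ _ _
  smul_mem' := by
    rintro c z ⟨v, hv, h1, h2⟩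
    refine ⟨c • v, hv.const_smul c, ?_, ?_⟩
    · exact (Lp.coeFn_smul _ _).trans (h1.const_smul c)
    · rw [gradient_const_smul' hv.differentiable]
      exact (Lp.coeFn_smul _ _).trans (h2.const_smul c)

theorem norm_sq_eq_integral {α F : Type*} [MeasurableSpace α] {ν : Measure α}
    [NormedAddCommGroup F] [InnerProductSpace ℝ F] (z : Lp F 2 ν) {g : α → F}
    (h : z =ᵐ[ν] g) : ‖z‖ ^ 2 = ∫ x, ‖g x‖ ^ 2 ∂ν := by
  rw [← real_inner_self_eq_norm_sq, L2.inner_def]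
  refine integral_congr_ae ?_
  filter_upwards [h] with x hx
  simp [hx]

theorem real_norm_sq_eq_integral {Ω : Set E} (z : Lp ℝ 2 (volume.restrict Ω)) {v : E → ℝ}
    (h : z =ᵐ[volume.restrict Ω] v) : ‖z‖ ^ 2 = ∫ x in Ω, v x ^ 2 := by
  simpa using norm_sq_eq_integral z h

/-- Integration by parts for an admissible function. -/
theorem IsAdmissible.hasWeakGradient {S : Set E} {v : E → ℝ} (hv : IsAdmissible S v)
    (Ω : Set E) : HasWeakGradient Ω v (gradient v) := by
  intro ψ hψ hψc hψΩ
  have hψa : IsAdmissible (∅ : Set E) ψ := ⟨hψ, hψc, by simp⟩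
  have hzero : ∀ x ∉ Ω, ψ x = 0 := fun x hx => image_eq_zero_of_notMem_tsupport fun h => hx (hψΩ h)
  have hzero' : ∀ x ∉ Ω, gradient ψ x = 0 := fun x hx => by
    have : fderiv ℝ ψ x = 0 := image_eq_zero_of_notMem_tsupport fun h =>
      hx (hψΩ (tsupport_fderiv_subset ℝ h))
    simp [gradient, this]
  rw [setIntegral_eq_integral_of_forall_compl_eq_zero (fun x hx => by simp [hzero' x hx]),
    setIntegral_eq_integral_of_forall_compl_eq_zero (fun x hx => by simp [hzero x hx])]
  have i1 : Integrable (fun x => v x • gradient ψ x) :=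
    (hv.contDiff.continuous.smul hψa.continuous_gradient).integrable_of_hasCompactSupport
      hv.hasCompactSupport.smul_right
  have i2 : Integrable (fun x => ψ x • gradient v x) :=
    (hψ.continuous.smul hv.continuous_gradient).integrable_of_hasCompactSupport
      hψc.smul_right
  have i3 : Integrable (fun x => v x * ψ x) :=
    (hv.contDiff.continuous.mul hψ.continuous).integrable_of_hasCompactSupport
      hv.hasCompactSupport.mul_right
  refine ext_inner_left ℝ fun e => ?_
  rw [inner_neg_right, ← integral_inner i1, ← integral_inner i2]
  simp only [inner_smul_right, inner_gradient_right]
  have j1 : Integrable (fun x => v x * fderiv ℝ ψ x e) := by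
    simpa only [inner_smul_right, inner_gradient_right] using i1.const_inner (𝕜 := ℝ) e
  have j2 : Integrable (fun x => ψ x * fderiv ℝ v x e) := by
    simpa only [inner_smul_right, inner_gradient_right] using i2.const_inner (𝕜 := ℝ) e
  rw [integral_mul_fderiv_eq_neg_fderiv_mul_of_integrable (by simpa only [mul_comm] using j2) j1 i3
    (fun x _ => hv.differentiable x) (fun x _ => hψa.differentiable x)]
  simp only [mul_comm]

/-- The weak gradient is a closed operator. -/
theorem hasWeakGradient_of_mem_closure {Ω S : Set E} {z : PairSpace Ω}
    (hz : z ∈ (admissiblePairs Ω S).topologicalClosure) : HasWeakGradient Ω z.fst z.snd := by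
  intro ψ hψ hψc hψΩ
  have hψa : IsAdmissible (∅ : Set E) ψ := ⟨hψ, hψc, by simp⟩
  have hL2 : ∀ z : PairSpace Ω, Integrable (fun x => z.fst x • gradient ψ x) (volume.restrict Ω) ∧
      Integrable (fun x => ψ x • z.snd x) (volume.restrict Ω) := fun z =>
    ⟨memLp_one_iff_integrable.1 ((hψa.memLp_gradient Ω).smul (Lp.memLp z.fst)),
      memLp_one_iff_integrable.1 ((Lp.memLp z.snd).smul (hψa.memLp Ω))⟩
  refine ext_inner_left ℝ fun e => ?_
  rw [inner_neg_right, ← integral_inner (hL2 z).1, ← integral_inner (hL2 z).2]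
  have hae : MemLp (fun x => ⟪e, gradient ψ x⟫_ℝ) 2 (volume.restrict Ω) :=
    (hψa.memLp_gradient Ω).const_inner e
  have hbe : MemLp (fun x => ψ x • e) 2 (volume.restrict Ω) := by
    have hc : Continuous fun x => ψ x • e := hψ.continuous.smul continuous_const
    exact (hc.memLp_of_hasCompactSupport hψc.smul_right).restrict Ω
  let a := hae.toLp
  let b := hbe.toLp
  have e1 : ∀ z : PairSpace Ω, ∫ x in Ω, ⟪e, z.fst x • gradient ψ x⟫_ℝ = ⟪a, z.fst⟫_ℝ := by
    intro z
    rw [L2.inner_def]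
    refine integral_congr_ae ?_
    filter_upwards [hae.coeFn_toLp] with x hx
    simp only [a, hx, inner_smul_right]
    simp
  have e2 : ∀ z : PairSpace Ω, ∫ x in Ω, ⟪e, ψ x • z.snd x⟫_ℝ = ⟪b, z.snd⟫_ℝ := by
    intro z
    rw [L2.inner_def]
    refine integral_congr_ae ?_
    filter_upwards [hbe.coeFn_toLp] with x hx
    simp only [b, hx, inner_smul_right, inner_smul_left]
    simp
  rw [e1, e2]
  have hfst : Continuous (fun x : PairSpace Ω => x.fst) := WithLp.continuous_fst _ _ _
  have hsnd : Continuous (fun x : PairSpace Ω => x.snd) := WithLp.continuous_snd _ _ _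
  have hcl : IsClosed {z : PairSpace Ω | ⟪a, z.fst⟫_ℝ = -⟪b, z.snd⟫_ℝ} :=
    isClosed_eq (continuous_const.inner hfst) (continuous_const.inner hsnd).neg
  refine closure_minimal ?_ hcl hz
  rintro w ⟨v, hv, h1, h2⟩
  have hw := congrArg (fun y => ⟪e, y⟫_ℝ) (hv.hasWeakGradient Ω ψ hψ hψc hψΩ)
  have c1 : ∫ x in Ω, v x • gradient ψ x = ∫ x in Ω, w.fst x • gradient ψ x :=
    integral_congr_ae (by filter_upwards [h1] with x hx; rw [hx])
  have c2 : ∫ x in Ω, ψ x • gradient v x = ∫ x in Ω, ψ x • w.snd x :=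
    integral_congr_ae (by filter_upwards [h2] with x hx; rw [hx])
  simp only [c1, c2, inner_neg_right] at hw
  rwa [← integral_inner (hL2 w).1, ← integral_inner (hL2 w).2, e1, e2] at hw

theorem memH1Zero_of_mem_closure {Ω S : Set E} {z : PairSpace Ω}
    (hz : z ∈ (admissiblePairs Ω S).topologicalClosure) : MemH1Zero Ω S z.fst z.snd where
  memLp_fun := Lp.memLp _
  memLp_grad := Lp.memLp _
  weakGradient := hasWeakGradient_of_mem_closure hz
  approx := by
    intro ε hε
    have hz' : z ∈ closure (admissiblePairs Ω S : Set (PairSpace Ω)) := hz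
    obtain ⟨w, ⟨v, hv, h1, h2⟩, hw⟩ := EMetric.mem_closure_iff.1 hz' ε hε
    refine ⟨v, hv.contDiff, hv.hasCompactSupport, hv.disjoint, ?_, ?_⟩
    · have : eLpNorm (fun x => v x - z.fst x) 2 (volume.restrict Ω) = edist w.fst z.fst := by
        rw [Lp.edist_def]
        exact eLpNorm_congr_ae (by filter_upwards [h1] with x hx; simp [hx])
      rw [this, edist_comm]
      exact (((WithLp.prod_lipschitzWith_ofLp 2 _ _).edist_le_mul z w).trans'
        (le_max_left _ _)).trans
        (by simpa using hw.le)
    · have : eLpNorm (fun x => gradient v x - z.snd x) 2 (volume.restrict Ω)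
          = edist w.snd z.snd := by
        rw [Lp.edist_def]
        exact eLpNorm_congr_ae (by filter_upwards [h2] with x hx; simp [hx])
      rw [this, edist_comm]
      exact (((WithLp.prod_lipschitzWith_ofLp 2 _ _).edist_le_mul z w).trans'
        (le_max_right _ _)).trans
        (by simpa using hw.le)

theorem mem_closure_of_memH1Zero {Ω S : Set E} {u : E → ℝ} {g : E → E}
    (h : MemH1Zero Ω S u g) :
    (WithLp.toLp 2 (h.memLp_fun.toLp, h.memLp_grad.toLp) : PairSpace Ω) ∈
      (admissiblePairs Ω S).topologicalClosure := by
  have hcont : Continuous (WithLp.toLp 2 :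
      Lp ℝ 2 (volume.restrict Ω) × Lp E 2 (volume.restrict Ω) → PairSpace Ω) :=
    WithLp.prod_continuous_toLp 2 _ _
  refine map_mem_closure (s := WithLp.toLp 2 ⁻¹' (admissiblePairs Ω S : Set (PairSpace Ω)))
    hcont ?_ fun _ h => h
  refine EMetric.mem_closure_iff.2 fun ε hε => ?_
  obtain ⟨δ, hδ, hδε⟩ := exists_between hε
  obtain ⟨v, hv1, hv2, hv3, a1, a2⟩ := h.approx δ hδ
  have hv : IsAdmissible S v := ⟨hv1, hv2, hv3⟩
  refine ⟨((hv.memLp Ω).toLp, (hv.memLp_gradient Ω).toLp),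
    ⟨v, hv, (hv.memLp Ω).coeFn_toLp, (hv.memLp_gradient Ω).coeFn_toLp⟩, lt_of_le_of_lt ?_ hδε⟩
  rw [edist_comm, Prod.edist_eq]
  refine max_le ?_ ?_
  · rw [Lp.edist_toLp_toLp]; exact a1
  · rw [Lp.edist_toLp_toLp]; exact a2

/-- Existence of an eigenvalue below the threshold `μ`, if some admissible function has Rayleigh
quotient below `μ` and if, up to a finite rank form, all Rayleigh quotients are at least `m`, for
any `m < μ`. -/
theorem exists_isEigenvalue_lt {Ω S : Set E} (μ : ℝ)
    (hlow : ∃ v, IsAdmissible S v ∧ ∫ x in Ω, ‖fderiv ℝ v x‖ ^ 2 < μ * ∫ x in Ω, v x ^ 2)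
    (hfin : ∀ m < μ, ∃ (κ : Type) (_ : Fintype κ) (f : κ → Lp ℝ 2 (volume.restrict Ω)) (C : ℝ),
      ∀ v, IsAdmissible S v →
      m * ∫ x in Ω, v x ^ 2 ≤
        (∫ x in Ω, ‖fderiv ℝ v x‖ ^ 2) + C * ∑ i, (∫ x in Ω, f i x * v x) ^ 2) :
    ∃ Λ < μ, IsEigenvalue Ω S Λ ∧ ∀ c, (∀ v, IsAdmissible S v →
      c * ∫ x in Ω, v x ^ 2 ≤ ∫ x in Ω, ‖fderiv ℝ v x‖ ^ 2) → c ≤ Λ := by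
  have hinner : ∀ (f : Lp ℝ 2 (volume.restrict Ω)) (w : PairSpace Ω) (v : E → ℝ),
      w.fst =ᵐ[volume.restrict Ω] v → ⟪f, w.fst⟫_ℝ = ∫ x in Ω, f x * v x := by
    intro f w v h
    rw [L2.inner_def]
    refine integral_congr_ae ?_
    filter_upwards [h] with x hx
    simp [hx, mul_comm]
  have hsnd : ∀ (w : PairSpace Ω) (v : E → ℝ), w.snd =ᵐ[volume.restrict Ω] gradient v →
      ‖w.snd‖ ^ 2 = ∫ x in Ω, ‖fderiv ℝ v x‖ ^ 2 := by
    intro w v h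
    simp only [norm_sq_eq_integral _ h, norm_gradient]
  obtain ⟨Λ, hΛ, ⟨z, hz, hz0, hzeq⟩, hmax⟩ := exists_minimizer (admissiblePairs Ω S) μ
    (by
      obtain ⟨v, hv, hlt⟩ := hlow
      have h1 := (hv.memLp Ω).coeFn_toLp
      have h2 := (hv.memLp_gradient Ω).coeFn_toLp
      refine ⟨WithLp.toLp 2 ((hv.memLp Ω).toLp, (hv.memLp_gradient Ω).toLp), ⟨v, hv, h1, h2⟩, ?_⟩
      change ‖(hv.memLp_gradient Ω).toLp‖ ^ 2 < μ * ‖(hv.memLp Ω).toLp‖ ^ 2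
      simpa only [real_norm_sq_eq_integral _ h1, norm_sq_eq_integral _ h2, norm_gradient] using hlt)
    (by
      intro m hm
      obtain ⟨κ, hκ, f, C, hs⟩ := hfin m hm
      refine ⟨κ, hκ, f, C, ?_⟩
      rintro w ⟨v, hv, h1, h2⟩
      rw [real_norm_sq_eq_integral _ h1, hsnd _ v h2]
      simp only [fun f => hinner f w v h1]
      exact hs v hv)
  refine ⟨Λ, hΛ, ⟨z.fst, z.snd, ⟨memH1Zero_of_mem_closure hz, ?_, ?_⟩⟩, fun c hc => hmax c ?_⟩
  · exact fun h => hz0 (Lp.eq_zero_iff_ae_eq_zero.2 h)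
  · intro v k hvk
    have h := hzeq _ (mem_closure_of_memH1Zero hvk)
    rw [L2.inner_def, L2.inner_def] at h
    have e1 : ∫ x in Ω, ⟪z.snd x, k x⟫_ℝ = ∫ x in Ω, ⟪z.snd x, (hvk.memLp_grad.toLp : E → E) x⟫_ℝ :=
      integral_congr_ae (by
        filter_upwards [hvk.memLp_grad.coeFn_toLp] with x hx; rw [hx])
    have e2 : ∫ x in Ω, z.fst x * v x = ∫ x in Ω, ⟪z.fst x, (hvk.memLp_fun.toLp : E → ℝ) x⟫_ℝ :=
      integral_congr_ae (by
        filter_upwards [hvk.memLp_fun.coeFn_toLp] with x hx; rw [hx]; simp [mul_comm])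
    rw [e1, e2]
    exact h
  · rintro w ⟨v, hv, h1, h2⟩
    rw [real_norm_sq_eq_integral _ h1, hsnd _ v h2]
    exact hc v hv

end Link

/-! ### The Poincaré inequality on convex sets -/

section Poincare

open Filter Topology

set_option linter.unusedSectionVars false

theorem sq_lintegral_le_lintegral_sq {α : Type*} [MeasurableSpace α] (ν : Measure α)
    [IsProbabilityMeasure ν] {f : α → ℝ≥0∞} (hf : AEMeasurable f ν) :
    (∫⁻ a, f a ∂ν) ^ 2 ≤ ∫⁻ a, f a ^ 2 ∂ν := by
  have h := ENNReal.lintegral_mul_le_Lp_mul_Lq ν Real.HolderConjugate.two_two hf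
    (aemeasurable_const (b := (1 : ℝ≥0∞)))
  simp only [Pi.mul_apply, mul_one, ENNReal.rpow_ofNat, one_pow, lintegral_one, measure_univ,
    ENNReal.one_rpow] at h
  calc (∫⁻ a, f a ∂ν) ^ 2 ≤ ((∫⁻ a, f a ^ 2 ∂ν) ^ (1 / 2 : ℝ)) ^ 2 := by gcongr
    _ = ∫⁻ a, f a ^ 2 ∂ν := by
      rw [← ENNReal.rpow_natCast, ← ENNReal.rpow_mul]; norm_num

variable {E : Type*} [NormedAddCommGroup E] [InnerProductSpace ℝ E] [FiniteDimensional ℝ E]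
  [MeasureSpace E] [BorelSpace E] [(volume : Measure E).IsAddHaarMeasure]

/-- The increment of a `C¹` function along a segment, by the fundamental theorem of calculus and
the Cauchy-Schwarz inequality. -/
theorem enorm_sub_sq_le_lintegral {v : E → ℝ} {U : Set E} (hU : IsOpen U)
    (hv : ContDiffOn ℝ 1 v U) (x w : E) (hseg : ∀ t ∈ Icc (0 : ℝ) 1, x + t • w ∈ U) :
    ‖v (x + w) - v x‖ₑ ^ 2 ≤
      ‖w‖ₑ ^ 2 * ∫⁻ t in Icc (0 : ℝ) 1, ‖fderiv ℝ v (x + t • w)‖ₑ ^ 2 := by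
  have hcont : ContinuousOn (fun t : ℝ => fderiv ℝ v (x + t • w)) (Icc 0 1) :=
    (hv.continuousOn_fderiv_of_isOpen hU le_rfl).comp (by fun_prop) hseg
  have hderiv : ∀ t ∈ uIcc (0 : ℝ) 1,
      HasDerivAt (fun t : ℝ => v (x + t • w)) (fderiv ℝ v (x + t • w) w) t := by
    intro t ht
    rw [uIcc_of_le zero_le_one] at ht
    have h1 : HasFDerivAt v (fderiv ℝ v (x + t • w)) (x + t • w) :=
      ((hv.differentiableOn (by simp)).differentiableAt (hU.mem_nhds (hseg t ht))).hasFDerivAt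
    have h2 : HasDerivAt (fun t : ℝ => x + t • w) w t := by
      simpa using ((hasDerivAt_id t).smul_const w).const_add x
    exact h1.comp_hasDerivAt t h2
  have hFTC := intervalIntegral.integral_eq_sub_of_hasDerivAt hderiv
    (((hcont.clm_apply continuousOn_const).mono
      (by rw [uIcc_of_le zero_le_one])).intervalIntegrable)
  simp only [one_smul, zero_smul, add_zero] at hFTC
  rw [← hFTC, intervalIntegral.integral_of_le zero_le_one, ← integral_Icc_eq_integral_Ioc]
  have hprob : IsProbabilityMeasure (volume.restrict (Icc (0 : ℝ) 1)) := ⟨by simp⟩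
  have hmeas : AEMeasurable (fun t : ℝ => ‖fderiv ℝ v (x + t • w)‖ₑ)
      (volume.restrict (Icc (0 : ℝ) 1)) :=
    (hcont.aestronglyMeasurable measurableSet_Icc).enorm
  calc ‖∫ t in Icc (0 : ℝ) 1, fderiv ℝ v (x + t • w) w‖ₑ ^ 2
      ≤ (∫⁻ t in Icc (0 : ℝ) 1, ‖fderiv ℝ v (x + t • w)‖ₑ * ‖w‖ₑ) ^ 2 := by
        gcongr
        refine (enorm_integral_le_lintegral_enorm _).trans (lintegral_mono fun t => ?_)
        exact ContinuousLinearMap.le_opENorm _ _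
    _ = ‖w‖ₑ ^ 2 * (∫⁻ t in Icc (0 : ℝ) 1, ‖fderiv ℝ v (x + t • w)‖ₑ) ^ 2 := by
        rw [lintegral_mul_const'' _ hmeas, mul_pow, mul_comm]
    _ ≤ _ := by
        gcongr
        exact sq_lintegral_le_lintegral_sq _ hmeas

theorem lintegral_comp_smul_add_le {F : E → ℝ≥0∞} (hF : Measurable F) {c : ℝ} (hc : 1 / 2 ≤ c)
    (a : E) : ∫⁻ y, F (c • y + a) ≤ 2 ^ Module.finrank ℝ E * ∫⁻ y, F y := by
  have hc0 : 0 < c := by linarith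
  have h1 : ∫⁻ y, F (c • y + a) = ∫⁻ y, F (y + a) ∂(Measure.map (c • ·) volume) := by
    rw [lintegral_map (by fun_prop) (by fun_prop)]
  rw [h1, Measure.map_addHaar_smul _ hc0.ne', lintegral_smul_measure, lintegral_add_right_eq_self,
    smul_eq_mul]
  gcongr
  rw [← inv_pow, abs_of_pos (by positivity), ← ENNReal.ofReal_ofNat,
    ← ENNReal.ofReal_pow (by norm_num)]
  apply ENNReal.ofReal_le_ofReal
  gcongr
  rw [inv_le_comm₀ hc0 (by norm_num)]
  linarith

/-- The Poincaré inequality on a convex set, in the form of a bound for the mean oscillation. In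
the convex combination `(1 - t) y + t x` one of the two coefficients is at least `1/2`, so one of
the two variables can be replaced by the combination at the cost of a Jacobian `≤ 2 ^ dim E`. -/
theorem lintegral_lintegral_enorm_sub_sq_le {v : E → ℝ} {U Q : Set E} (hU : IsOpen U)
    (hv : ContDiffOn ℝ 1 v U) (hQU : Q ⊆ U) (hQ : Convex ℝ Q) (hQm : MeasurableSet Q)
    {D : ℝ≥0∞} (hD : ∀ x ∈ Q, ∀ y ∈ Q, ‖x - y‖ₑ ≤ D) :
    ∫⁻ x in Q, ∫⁻ y in Q, ‖v x - v y‖ₑ ^ 2 ≤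
      D ^ 2 * (2 ^ Module.finrank ℝ E * volume Q * ∫⁻ x in Q, ‖fderiv ℝ v x‖ₑ ^ 2) := by
  -- the integrand is cut off at `Q`, so that the change of variables can be made on the whole space
  let F : E → ℝ≥0∞ := Q.indicator fun x => ‖fderiv ℝ v x‖ₑ ^ 2
  have hF : Measurable F := by
    have := (measurable_fderiv ℝ v).enorm.pow_const 2
    exact this.indicator hQm
  have hFint : ∫⁻ x, F x = ∫⁻ x in Q, ‖fderiv ℝ v x‖ₑ ^ 2 := lintegral_indicator hQm _
  rw [← hFint]
  have hbound : ∀ x ∈ Q, ∀ y ∈ Q, ‖v x - v y‖ₑ ^ 2 ≤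
      D ^ 2 * ∫⁻ t in Icc (0 : ℝ) 1, F ((1 - t) • y + t • x) := by
    intro x hx y hy
    have hmem : ∀ t ∈ Icc (0 : ℝ) 1, y + t • (x - y) ∈ Q := fun t ht =>
      hQ.add_smul_sub_mem hy hx ht
    have h := enorm_sub_sq_le_lintegral hU hv y (x - y) fun t ht => hQU (hmem t ht)
    rw [add_sub_cancel] at h
    refine h.trans ?_
    refine mul_le_mul' (by gcongr; exact hD x hx y hy) (le_of_eq ?_)
    refine setLIntegral_congr_fun measurableSet_Icc fun t ht => ?_
    have e : y + t • (x - y) = (1 - t) • y + t • x := by module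
    have hm := hmem t ht
    rw [e] at hm
    simp only [F, e]
    rw [indicator_of_mem hm]
  have hmeas : Measurable fun p : E × E × ℝ => F ((1 - p.2.2) • p.2.1 + p.2.2 • p.1) := by
    fun_prop
  have ht : ∀ t ∈ Icc (0 : ℝ) 1, ∫⁻ x in Q, ∫⁻ y in Q, F ((1 - t) • y + t • x) ≤
      2 ^ Module.finrank ℝ E * volume Q * ∫⁻ x, F x := by
    intro t ht
    have hmt : Measurable fun p : E × E => F ((1 - t) • p.2 + t • p.1) := by fun_prop
    rcases le_total t (1 / 2) with h | h
    · calc ∫⁻ x in Q, ∫⁻ y in Q, F ((1 - t) • y + t • x)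
          ≤ ∫⁻ x in Q, 2 ^ Module.finrank ℝ E * ∫⁻ y, F y := by
            refine lintegral_mono fun x => (setLIntegral_le_lintegral _ _).trans ?_
            exact lintegral_comp_smul_add_le hF (by linarith) _
        _ = _ := by rw [setLIntegral_const]; ring
    · rw [lintegral_lintegral_swap hmt.aemeasurable]
      calc ∫⁻ y in Q, ∫⁻ x in Q, F ((1 - t) • y + t • x)
          ≤ ∫⁻ y in Q, 2 ^ Module.finrank ℝ E * ∫⁻ y, F y := by
            refine lintegral_mono fun y => (setLIntegral_le_lintegral _ _).trans ?_
            simp only [add_comm ((1 - t) • y)]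
            exact lintegral_comp_smul_add_le hF h _
        _ = _ := by rw [setLIntegral_const]; ring
  calc ∫⁻ x in Q, ∫⁻ y in Q, ‖v x - v y‖ₑ ^ 2
      ≤ ∫⁻ x in Q, ∫⁻ y in Q, D ^ 2 * ∫⁻ t in Icc (0 : ℝ) 1, F ((1 - t) • y + t • x) := by
        exact setLIntegral_mono' hQm fun x hx =>
          setLIntegral_mono' hQm fun y hy => hbound x hx y hy
    _ = D ^ 2 * ∫⁻ x in Q, ∫⁻ y in Q, ∫⁻ t in Icc (0 : ℝ) 1, F ((1 - t) • y + t • x) := by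
        have h1 : Measurable fun p : E × E =>
            ∫⁻ t in Icc (0 : ℝ) 1, F ((1 - t) • p.2 + t • p.1) := by
          have : Measurable fun q : (E × E) × ℝ => F ((1 - q.2) • q.1.2 + q.2 • q.1.1) := by
            fun_prop
          exact this.lintegral_prod_right'
        rw [← lintegral_const_mul _ h1.lintegral_prod_right']
        refine lintegral_congr fun x => ?_
        exact lintegral_const_mul _ (h1.comp measurable_prodMk_left)
    _ = D ^ 2 * ∫⁻ t in Icc (0 : ℝ) 1, ∫⁻ x in Q, ∫⁻ y in Q, F ((1 - t) • y + t • x) := by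
        congr 1
        have h2 : ∀ x, ∫⁻ y in Q, ∫⁻ t in Icc (0 : ℝ) 1, F ((1 - t) • y + t • x) =
            ∫⁻ t in Icc (0 : ℝ) 1, ∫⁻ y in Q, F ((1 - t) • y + t • x) := fun x =>
          lintegral_lintegral_swap (hmeas.comp measurable_prodMk_left).aemeasurable
        simp only [h2]
        refine lintegral_lintegral_swap (Measurable.aemeasurable ?_)
        have : Measurable fun q : (E × ℝ) × E => F ((1 - q.1.2) • q.2 + q.1.2 • q.1.1) := by
          fun_prop
        exact this.lintegral_prod_right'
    _ ≤ D ^ 2 * ∫⁻ t in Icc (0 : ℝ) 1, 2 ^ Module.finrank ℝ E * volume Q * ∫⁻ x, F x := by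
        refine mul_le_mul_right ?_ _
        exact setLIntegral_mono' measurableSet_Icc ht
    _ = _ := by simp

/-- The Poincaré inequality on a convex set of diameter at most `D`. -/
theorem setIntegral_sq_le {v : E → ℝ} {U Q : Set E} (hU : IsOpen U)
    (hv : ContDiffOn ℝ 1 v U) (hQU : Q ⊆ U) (hQ : Convex ℝ Q) (hQm : MeasurableSet Q)
    (hfin : volume Q ≠ ∞) {D : ℝ} (hD0 : 0 ≤ D) (hD : ∀ x ∈ Q, ∀ y ∈ Q, ‖x - y‖ ≤ D)
    (hv2 : MemLp v 2 (volume.restrict Q))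
    (hdv : IntegrableOn (fun x => ‖fderiv ℝ v x‖ ^ 2) Q) :
    ∫ x in Q, v x ^ 2 ≤ (volume.real Q)⁻¹ * (∫ x in Q, v x) ^ 2 +
      D ^ 2 * 2 ^ Module.finrank ℝ E * ∫ x in Q, ‖fderiv ℝ v x‖ ^ 2 := by
  have hfinm : IsFiniteMeasure (volume.restrict Q) := ⟨by simpa using hfin.lt_top⟩
  -- for a null set the inverse of the volume is the junk value `0`, but both sides vanish
  rcases eq_or_ne (volume Q) 0 with h0 | h0
  · simp [Measure.restrict_eq_zero.2 h0]
  have hq : 0 < volume.real Q := ENNReal.toReal_pos h0 hfin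
  have hv1 : IntegrableOn v Q := hv2.integrable (by norm_num)
  have hvs : IntegrableOn (fun x => v x ^ 2) Q := hv2.integrable_sq
  set q := volume.real Q
  set m := ∫ x in Q, v x
  set s := ∫ x in Q, v x ^ 2
  set I := ∫ x in Q, ‖fderiv ℝ v x‖ ^ 2
  have hI : 0 ≤ I := integral_nonneg fun x => by positivity
  have hquad : ∀ a b c : ℝ, IntegrableOn (fun y => a * v y ^ 2 + b * v y + c) Q ∧
      ∫ y in Q, (a * v y ^ 2 + b * v y + c) = a * s + b * m + c * q := fun a b c => by
    have h1 : IntegrableOn (fun y => a * v y ^ 2) Q := hvs.const_mul a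
    have h2 : IntegrableOn (fun y => b * v y) Q := hv1.const_mul b
    have h12 : IntegrableOn (fun y => a * v y ^ 2 + b * v y) Q := h1.add h2
    refine ⟨h12.add (integrable_const c), ?_⟩
    rw [integral_add h12 (integrable_const c), integral_add h1 h2, integral_const_mul,
      integral_const_mul]
    simp only [integral_const, measureReal_restrict_apply_univ, smul_eq_mul]
    ring
  have hexp : ∀ x, (fun y => (v x - v y) ^ 2) =
      fun y => 1 * v y ^ 2 + (-2 * v x) * v y + v x ^ 2 := fun x => by ext y; ring
  have hint : ∀ x, IntegrableOn (fun y => (v x - v y) ^ 2) Q := fun x => by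
    rw [hexp]; exact (hquad _ _ _).1
  have hinner : ∀ x, ∫ y in Q, (v x - v y) ^ 2 = q * v x ^ 2 + (-2 * m) * v x + s := by
    intro x
    rw [hexp, (hquad _ _ _).2]
    ring
  have houter : ∫ x in Q, (q * v x ^ 2 + (-2 * m) * v x + s) = 2 * (q * s - m ^ 2) := by
    rw [(hquad _ _ _).2]
    ring
  have hlint : ENNReal.ofReal (2 * (q * s - m ^ 2)) = ∫⁻ x in Q, ∫⁻ y in Q, ‖v x - v y‖ₑ ^ 2 := by
    rw [← houter, ofReal_integral_eq_lintegral_ofReal (hquad _ _ _).1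
      (ae_of_all _ fun x => by
        simp only [Pi.zero_apply]
        rw [← hinner x]; exact integral_nonneg fun y => by positivity)]
    refine lintegral_congr fun x => ?_
    rw [← hinner x, ofReal_integral_eq_lintegral_ofReal (hint x)
      (ae_of_all _ fun y => by positivity)]
    refine lintegral_congr fun y => ?_
    rw [← sq_abs, ENNReal.ofReal_pow (abs_nonneg _), ← Real.norm_eq_abs, ofReal_norm]
  have hD' : ∀ x ∈ Q, ∀ y ∈ Q, ‖x - y‖ₑ ≤ ENNReal.ofReal D := fun x hx y hy => by
    rw [← ofReal_norm]; exact ENNReal.ofReal_le_ofReal (hD x hx y hy)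
  have hmain := lintegral_lintegral_enorm_sub_sq_le hU hv hQU hQ hQm hD'
  have hlI : ∫⁻ x in Q, ‖fderiv ℝ v x‖ₑ ^ 2 = ENNReal.ofReal I := by
    rw [ofReal_integral_eq_lintegral_ofReal hdv (ae_of_all _ fun y => by positivity)]
    refine lintegral_congr fun y => ?_
    rw [ENNReal.ofReal_pow (norm_nonneg _), ofReal_norm]
  have h2 : (2 : ℝ≥0∞) = ENNReal.ofReal (2 : ℝ) := by simp
  rw [← hlint, hlI, ← ENNReal.ofReal_toReal hfin, h2,
    ← ENNReal.ofReal_pow hD0, ← ENNReal.ofReal_pow zero_le_two,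
    ← ENNReal.ofReal_mul (by positivity), ← ENNReal.ofReal_mul (by positivity),
    ← ENNReal.ofReal_mul (by positivity), ENNReal.ofReal_le_ofReal_iff (by positivity)] at hmain
  change 2 * (q * s - m ^ 2) ≤ D ^ 2 * (2 ^ Module.finrank ℝ E * q * I) at hmain
  rw [← mul_le_mul_iff_right₀ hq, mul_add, mul_inv_cancel_left₀ hq.ne']
  have : 0 ≤ D ^ 2 * (2 ^ Module.finrank ℝ E * q * I) := by positivity
  nlinarith

end Poincare

/-! ### Local compactness by averaging over grid cells -/

section LocalCompactness

open Filter Topology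

set_option linter.unusedSectionVars false

variable {E : Type*} [NormedAddCommGroup E] [InnerProductSpace ℝ E] [FiniteDimensional ℝ E]

/-- The half-open cube with index `k` in the grid of mesh `1 / N`, with respect to the standard
orthonormal basis. -/
def gridCell (N : ℕ) (k : Fin (Module.finrank ℝ E) → ℤ) : Set E :=
  {x | ∀ i, ⌊(N : ℝ) * ⟪stdOrthonormalBasis ℝ E i, x⟫_ℝ⌋ = k i}

theorem convex_gridCell (N : ℕ) (k : Fin (Module.finrank ℝ E) → ℤ) :
    Convex ℝ (gridCell (E := E) N k) := by
  intro x hx y hy a b ha hb hab i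
  have h1 := Int.floor_eq_iff.1 (hx i)
  have h2 := Int.floor_eq_iff.1 (hy i)
  rw [Int.floor_eq_iff, inner_add_right, inner_smul_right, inner_smul_right]
  set p := (N : ℝ) * ⟪stdOrthonormalBasis ℝ E i, x⟫_ℝ with hp
  set q := (N : ℝ) * ⟪stdOrthonormalBasis ℝ E i, y⟫_ℝ with hq
  have e : (N : ℝ) * (a * ⟪stdOrthonormalBasis ℝ E i, x⟫_ℝ +
      b * ⟪stdOrthonormalBasis ℝ E i, y⟫_ℝ) = a * p + b * q := by rw [hp, hq]; ring
  have e2 : (k i : ℝ) = a * k i + b * k i := by rw [← add_mul, hab, one_mul]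
  have e3 : (k i : ℝ) + 1 = a * (k i + 1) + b * (k i + 1) := by rw [← add_mul, hab, one_mul]
  rw [e]
  constructor
  · rw [e2]
    have := h1.1; have := h2.1
    gcongr
  · rw [e3]
    rcases ha.eq_or_lt with rfl | ha
    · have hb1 : b = 1 := by linarith
      subst hb1; linarith
    · have := h1.2; have := h2.2.le
      have : a * p < a * (k i + 1) := by gcongr
      have : b * q ≤ b * (k i + 1) := by gcongr
      linarith

theorem norm_sub_le_of_mem_gridCell {N : ℕ} (hN : 0 < N) {k : Fin (Module.finrank ℝ E) → ℤ}
    {x y : E} (hx : x ∈ gridCell N k) (hy : y ∈ gridCell N k) :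
    ‖x - y‖ ≤ Real.sqrt (Module.finrank ℝ E) / N := by
  have hN' : (0 : ℝ) < N := by exact_mod_cast hN
  rw [le_div_iff₀ hN', Real.le_sqrt (by positivity) (by positivity), mul_pow,
    ← (stdOrthonormalBasis ℝ E).sum_sq_norm_inner_right, Finset.sum_mul]
  calc ∑ i, ‖⟪stdOrthonormalBasis ℝ E i, x - y⟫_ℝ‖ ^ 2 * (N : ℝ) ^ 2
      ≤ ∑ i : Fin (Module.finrank ℝ E), (1 : ℝ) := by
        refine Finset.sum_le_sum fun i _ => ?_
        have h1 := Int.floor_eq_iff.1 (hx i)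
        have h2 := Int.floor_eq_iff.1 (hy i)
        rw [Real.norm_eq_abs, sq_abs, ← mul_pow, sq_le_one_iff_abs_le_one, inner_sub_right,
          abs_le]
        constructor <;> nlinarith
    _ = _ := by simp

theorem finite_gridCell_inter {N : ℕ} {K : Set E} (hK : Bornology.IsBounded K) :
    {k | (K ∩ gridCell (E := E) N k).Nonempty}.Finite := by
  obtain ⟨R, hR⟩ := hK.exists_norm_le
  refine (Set.finite_Icc (fun _ => ⌊-(N * R)⌋) (fun _ => ⌊N * R⌋)).subset ?_
  rintro k ⟨x, hxK, hxk⟩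
  have hb : ∀ i, |(N : ℝ) * ⟪stdOrthonormalBasis ℝ E i, x⟫_ℝ| ≤ N * R := fun i => by
    rw [abs_mul, Nat.abs_cast]
    gcongr
    refine (abs_real_inner_le_norm _ _).trans ?_
    rw [(stdOrthonormalBasis ℝ E).norm_eq_one, one_mul]
    exact hR x hxK
  refine ⟨fun i => ?_, fun i => ?_⟩
  · rw [← hxk i]; exact Int.floor_le_floor (neg_le_of_abs_le (hb i))
  · rw [← hxk i]; exact Int.floor_le_floor (le_of_abs_le (hb i))

/-- The extension by zero across the part `S` of the boundary. -/
theorem IsAdmissible.indicator_eventuallyEq {Ω S : Set E} (hΩ : IsOpen Ω) {v : E → ℝ}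
    (hv : IsAdmissible S v) {x : E} (hx : x ∈ frontier Ω → x ∈ closure S) :
    (x ∈ Ω ∧ Ω.indicator v =ᶠ[𝓝 x] v) ∨ (x ∉ Ω ∧ Ω.indicator v =ᶠ[𝓝 x] 0) := by
  by_cases hxΩ : x ∈ Ω
  · refine Or.inl ⟨hxΩ, ?_⟩
    filter_upwards [hΩ.mem_nhds hxΩ] with y hy
    exact indicator_of_mem hy _
  · refine Or.inr ⟨hxΩ, ?_⟩
    by_cases hxc : x ∈ closure Ω
    · have hS := hx ⟨hxc, by rwa [hΩ.interior_eq]⟩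
      have : x ∉ tsupport v := fun h => hv.disjoint.le_bot ⟨h, hS⟩
      filter_upwards [notMem_tsupport_iff_eventuallyEq.1 this] with y hy
      simp [hy]
    · filter_upwards [isClosed_closure.isOpen_compl.mem_nhds hxc] with y hy
      exact indicator_of_notMem (fun h => hy (subset_closure h)) _

theorem IsAdmissible.contDiffAt_indicator {Ω S : Set E} (hΩ : IsOpen Ω) {v : E → ℝ}
    (hv : IsAdmissible S v) {x : E} (hx : x ∈ frontier Ω → x ∈ closure S) :
    ContDiffAt ℝ (⊤ : ℕ∞) (Ω.indicator v) x := by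
  rcases hv.indicator_eventuallyEq hΩ hx with ⟨-, h⟩ | ⟨-, h⟩
  · exact hv.contDiff.contDiffAt.congr_of_eventuallyEq h
  · exact (contDiff_const (c := (0 : ℝ))).contDiffAt.congr_of_eventuallyEq h

theorem IsAdmissible.fderiv_indicator {Ω S : Set E} (hΩ : IsOpen Ω) {v : E → ℝ}
    (hv : IsAdmissible S v) {x : E} (hx : x ∈ frontier Ω → x ∈ closure S) :
    fderiv ℝ (Ω.indicator v) x = Ω.indicator (fderiv ℝ v) x := by
  rcases hv.indicator_eventuallyEq hΩ hx with ⟨hxΩ, h⟩ | ⟨hxΩ, h⟩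
  · rw [h.fderiv_eq, indicator_of_mem hxΩ]
  · rw [h.fderiv_eq, indicator_of_notMem hxΩ, fderiv_zero, Pi.zero_apply]

variable [MeasureSpace E] [BorelSpace E] [(volume : Measure E).IsAddHaarMeasure]

theorem measurableSet_gridCell (N : ℕ) (k : Fin (Module.finrank ℝ E) → ℤ) :
    MeasurableSet (gridCell (E := E) N k) := by
  have : gridCell (E := E) N k =
      ⋂ i, (fun x => ⌊(N : ℝ) * ⟪stdOrthonormalBasis ℝ E i, x⟫_ℝ⌋) ⁻¹' {k i} := by
    ext x; simp [gridCell]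
  rw [this]
  refine MeasurableSet.iInter fun i => ?_
  have hm : Measurable fun x => ⌊(N : ℝ) * ⟪stdOrthonormalBasis ℝ E i, x⟫_ℝ⌋ :=
    Int.measurable_floor.comp (by fun_prop)
  exact hm (measurableSet_singleton _)

theorem volume_gridCell_ne_top {N : ℕ} (hN : 0 < N) (k : Fin (Module.finrank ℝ E) → ℤ) :
    volume (gridCell (E := E) N k) ≠ ∞ := by
  refine (Bornology.IsBounded.measure_lt_top ?_).ne
  exact Metric.isBounded_iff.2 ⟨_, fun x hx y hy => by
    rw [dist_eq_norm]; exact norm_sub_le_of_mem_gridCell hN hx hy⟩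

/-- The Poincaré inequality in a grid cell that meets the boundary of `Ω` within `closure S` only,
for an admissible function extended by zero. -/
theorem IsAdmissible.setIntegral_gridCell_le {Ω S : Set E} (hΩ : IsOpen Ω) {v : E → ℝ}
    (hv : IsAdmissible S v) {N : ℕ} (hN : 0 < N) {k : Fin (Module.finrank ℝ E) → ℤ} {U : Set E}
    (hU : IsOpen U) (hkU : gridCell N k ⊆ U) (hUS : U ∩ frontier Ω ⊆ closure S) :
    ∫ x in gridCell N k ∩ Ω, v x ^ 2 ≤
      (volume.real (gridCell N k))⁻¹ * (∫ x in gridCell N k ∩ Ω, v x) ^ 2 +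
      (Real.sqrt (Module.finrank ℝ E) / N) ^ 2 * 2 ^ Module.finrank ℝ E *
        ∫ x in gridCell N k ∩ Ω, ‖fderiv ℝ v x‖ ^ 2 := by
  set Q := gridCell N k
  have hQm : MeasurableSet Q := measurableSet_gridCell N k
  have hd : ∀ x ∈ Q, fderiv ℝ (Ω.indicator v) x = Ω.indicator (fderiv ℝ v) x := fun x hx =>
    hv.fderiv_indicator hΩ fun h => hUS ⟨hkU hx, h⟩
  have hdd : ∀ x ∈ Q, ‖fderiv ℝ (Ω.indicator v) x‖ ^ 2 =
      Ω.indicator (fun x => ‖fderiv ℝ v x‖ ^ 2) x := fun x hx => by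
    rw [hd x hx]
    by_cases hxΩ : x ∈ Ω <;> simp [hxΩ]
  have h := setIntegral_sq_le (v := Ω.indicator v) hU
    (fun x hx => ((hv.contDiffAt_indicator hΩ fun h => hUS ⟨hx, h⟩).of_le
      (by simp)).contDiffWithinAt) hkU (convex_gridCell N k) hQm
    (volume_gridCell_ne_top hN k) (by positivity)
    (fun x hx y hy => norm_sub_le_of_mem_gridCell hN hx hy)
    ((hv.memLp univ).indicator hΩ.measurableSet |>.mono_measure
      (by simpa using Measure.restrict_le_self))
    ((integrableOn_congr_fun hdd hQm).2
      ((hv.integrable_fderiv_sq Q).indicator hΩ.measurableSet))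
  have e1 : ∫ x in Q, Ω.indicator v x ^ 2 = ∫ x in Q ∩ Ω, v x ^ 2 := by
    rw [← setIntegral_indicator hΩ.measurableSet]
    refine integral_congr_ae (ae_of_all _ fun x => ?_)
    by_cases hxΩ : x ∈ Ω <;> simp [hxΩ]
  rw [e1, setIntegral_indicator hΩ.measurableSet, setIntegral_congr_fun hQm hdd,
    setIntegral_indicator hΩ.measurableSet] at h
  exact h

/-- Local compactness: up to a finite rank form (the averages over small cells), the `L²` norm over
a bounded set `K` at a positive distance from the part of the boundary that carries no Dirichlet
condition is dominated by a small multiple of the Dirichlet integral. -/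
theorem exists_finite_rank_bound {Ω S K : Set E} (hΩ : IsOpen Ω) (hK : Bornology.IsBounded K)
    (hKΩ : K ⊆ Ω) {r : ℝ} (hr : 0 < r)
    (hrS : ∀ x ∈ K, Metric.ball x r ∩ frontier Ω ⊆ closure S) {ε : ℝ} (hε : 0 < ε) :
    ∃ (κ : Type) (_ : Fintype κ) (f : κ → Lp ℝ 2 (volume.restrict Ω)), ∀ v, IsAdmissible S v →
      ∫ x in K, v x ^ 2 ≤
        ε * (∫ x in Ω, ‖fderiv ℝ v x‖ ^ 2) + ∑ i, (∫ x in Ω, f i x * v x) ^ 2 := by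
  set n := Module.finrank ℝ E
  obtain ⟨N, hN, hNr, hNε⟩ : ∃ N : ℕ, 0 < N ∧ Real.sqrt n / N < r ∧
      (Real.sqrt n / N) ^ 2 * 2 ^ n ≤ ε := by
    have h1 : Tendsto (fun N : ℕ => Real.sqrt n / (N : ℝ)) atTop (𝓝 0) :=
      tendsto_const_div_atTop_nhds_zero_nat _
    have h2 : Tendsto (fun N : ℕ => (Real.sqrt n / (N : ℝ)) ^ 2 * 2 ^ n) atTop (𝓝 0) := by
      simpa using (h1.pow 2).mul_const ((2 : ℝ) ^ n)
    obtain ⟨N, h⟩ := ((eventually_gt_atTop 0).and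
      ((h1.eventually_lt_const hr).and (h2.eventually_le_const hε))).exists
    exact ⟨N, h⟩
  have hfin := finite_gridCell_inter (N := N) hK
  let ks := hfin.toFinset
  have hmeas : ∀ k, MeasurableSet (gridCell (E := E) N k) := measurableSet_gridCell N
  have hvol : ∀ k, (volume.restrict Ω) (gridCell N k) ≠ ∞ := fun k =>
    ((Measure.restrict_apply_le _ _).trans_lt (volume_gridCell_ne_top hN k).lt_top).ne
  have hdisj : ∀ A : Set E, (ks : Set (Fin n → ℤ)).PairwiseDisjoint
      (fun k => gridCell N k ∩ A) := fun A k _ k' _ hkk' => by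
    refine Set.disjoint_left.2 fun x hx hx' => hkk' ?_
    ext i
    rw [← hx.1 i, ← hx'.1 i]
  refine ⟨ks, inferInstance, fun k => indicatorConstLp 2 (hmeas k) (hvol k)
    (Real.sqrt (volume.real (gridCell N (k : Fin n → ℤ))))⁻¹, fun v hv => ?_⟩
  have hsum : ∀ k, (∫ x in Ω, indicatorConstLp 2 (hmeas k) (hvol k)
      (Real.sqrt (volume.real (gridCell N k)))⁻¹ x * v x) ^ 2 =
      (volume.real (gridCell N k))⁻¹ * (∫ x in gridCell N k ∩ Ω, v x) ^ 2 := by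
    intro k
    have : ∫ x in Ω, indicatorConstLp 2 (hmeas k) (hvol k)
        (Real.sqrt (volume.real (gridCell N k)))⁻¹ x * v x =
        ∫ x in Ω, (gridCell N k).indicator
          (fun x => (Real.sqrt (volume.real (gridCell N k)))⁻¹ * v x) x := by
      refine integral_congr_ae ?_
      filter_upwards [indicatorConstLp_coeFn (p := 2) (hs := hmeas k) (hμs := hvol k)
        (c := (Real.sqrt (volume.real (gridCell N k)))⁻¹)] with x hx
      rw [hx]
      by_cases hxk : x ∈ gridCell N k <;> simp [hxk]
    rw [this, setIntegral_indicator (hmeas k), integral_const_mul, mul_pow, inv_pow,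
      Real.sq_sqrt measureReal_nonneg, inter_comm]
  rw [Finset.sum_coe_sort ks (fun k => (∫ x in Ω, indicatorConstLp 2 (hmeas k) (hvol k)
      (Real.sqrt (volume.real (gridCell N k)))⁻¹ x * v x) ^ 2)]
  simp only [hsum]
  have hKsub : K ⊆ ⋃ k ∈ ks, gridCell N k ∩ Ω := fun x hx => by
    have hxk : x ∈ gridCell N (fun i => ⌊(N : ℝ) * ⟪stdOrthonormalBasis ℝ E i, x⟫_ℝ⌋) :=
      fun i => rfl
    exact mem_biUnion (hfin.mem_toFinset.2 ⟨x, hx, hxk⟩) ⟨hxk, hKΩ hx⟩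
  have hmeas' : ∀ k ∈ ks, MeasurableSet (gridCell N k ∩ Ω) := fun k _ =>
    (hmeas k).inter hΩ.measurableSet
  have hI : ∑ k ∈ ks, ∫ x in gridCell N k ∩ Ω, ‖fderiv ℝ v x‖ ^ 2 ≤
      ∫ x in Ω, ‖fderiv ℝ v x‖ ^ 2 := by
    rw [← integral_biUnion_finset _ hmeas' (hdisj Ω) fun k _ => hv.integrable_fderiv_sq _]
    exact setIntegral_mono_set (hv.integrable_fderiv_sq _) (ae_of_all _ fun x => by positivity)
      (iUnion₂_subset fun k _ => inter_subset_right).eventuallyLE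
  calc ∫ x in K, v x ^ 2 ≤ ∫ x in ⋃ k ∈ ks, gridCell N k ∩ Ω, v x ^ 2 :=
        setIntegral_mono_set (hv.integrable_sq _) (ae_of_all _ fun x => by positivity)
          hKsub.eventuallyLE
    _ = ∑ k ∈ ks, ∫ x in gridCell N k ∩ Ω, v x ^ 2 :=
        integral_biUnion_finset _ hmeas' (hdisj Ω) fun k _ => hv.integrable_sq _
    _ ≤ ∑ k ∈ ks, ((volume.real (gridCell N k))⁻¹ * (∫ x in gridCell N k ∩ Ω, v x) ^ 2 +
          ε * ∫ x in gridCell N k ∩ Ω, ‖fderiv ℝ v x‖ ^ 2) := by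
        refine Finset.sum_le_sum fun k hk => ?_
        obtain ⟨x₀, hx₀K, hx₀k⟩ := hfin.mem_toFinset.1 hk
        refine (hv.setIntegral_gridCell_le hΩ hN Metric.isOpen_ball (fun x hx => ?_)
          (hrS x₀ hx₀K)).trans ?_
        · rw [mem_ball_iff_norm]
          exact (norm_sub_le_of_mem_gridCell hN hx hx₀k).trans_lt hNr
        · have : 0 ≤ ∫ x in gridCell N k ∩ Ω, ‖fderiv ℝ v x‖ ^ 2 :=
            integral_nonneg fun x => by positivity
          gcongr
    _ ≤ _ := by
        rw [Finset.sum_add_distrib, ← Finset.mul_sum, add_comm]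
        gcongr

end LocalCompactness

/-! ### Vertical shifts and the first Dirichlet eigenvalue -/

section Bounds

open Filter Topology

set_option linter.unusedSectionVars false

variable {E : Type*} [NormedAddCommGroup E] [InnerProductSpace ℝ E] [FiniteDimensional ℝ E]
  [MeasureSpace E] [BorelSpace E] [(volume : Measure E).IsAddHaarMeasure]

/-- If `Ω` is stable under the shifts by `t w`, `t ∈ [0, 1]`, and `A + w ⊆ B`, then the `L²` norm
over `A` is controlled by that over `B` and by the Dirichlet integral. -/
theorem IsAdmissible.setIntegral_sq_le_shift {S : Set E} {v : E → ℝ} (hv : IsAdmissible S v)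
    {Ω A B : Set E} (hΩ : MeasurableSet Ω) (hA : MeasurableSet A) (hB : MeasurableSet B)
    (hAΩ : A ⊆ Ω) {w : E} (hw : ∀ x ∈ Ω, ∀ t ∈ Icc (0 : ℝ) 1, x + t • w ∈ Ω)
    (hAB : ∀ x ∈ A, x + w ∈ B) :
    ∫ x in A, v x ^ 2 ≤
      2 * ‖w‖ ^ 2 * (∫ x in Ω, ‖fderiv ℝ v x‖ ^ 2) + 2 * ∫ x in B, v x ^ 2 := by
  have hshift : ∀ {F : E → ℝ≥0∞} {A B : Set E} {w : E}, MeasurableSet A → MeasurableSet B →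
      (∀ x ∈ A, x + w ∈ B) → ∫⁻ x in A, F (x + w) ≤ ∫⁻ x in B, F x := by
    intro F A B w hA hB hAB
    rw [← lintegral_indicator hA, ← lintegral_indicator hB,
      ← lintegral_add_right_eq_self (B.indicator F) w]
    refine lintegral_mono fun x => ?_
    by_cases hx : x ∈ A
    · rw [indicator_of_mem hx, indicator_of_mem (hAB x hx)]
    · simp [hx]
  have hsq : ∀ G : Set E, ∫⁻ x in G, ‖v x‖ₑ ^ 2 = ENNReal.ofReal (∫ x in G, v x ^ 2) := by
    intro G
    rw [ofReal_integral_eq_lintegral_ofReal (hv.integrable_sq G)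
      (ae_of_all _ fun y => by positivity)]
    refine lintegral_congr fun y => ?_
    rw [← sq_abs, ENNReal.ofReal_pow (abs_nonneg _), ← Real.norm_eq_abs, ofReal_norm]
  have hdsq : ∫⁻ x in Ω, ‖fderiv ℝ v x‖ₑ ^ 2 =
      ENNReal.ofReal (∫ x in Ω, ‖fderiv ℝ v x‖ ^ 2) := by
    rw [ofReal_integral_eq_lintegral_ofReal (hv.integrable_fderiv_sq Ω)
      (ae_of_all _ fun y => by positivity)]
    refine lintegral_congr fun y => ?_
    rw [ENNReal.ofReal_pow (norm_nonneg _), ofReal_norm]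
  have hcv : Continuous v := hv.contDiff.continuous
  have hcd := hv.continuous_fderiv
  have hdiff : ∫⁻ x in A, ‖v (x + w) - v x‖ₑ ^ 2 ≤
      ‖w‖ₑ ^ 2 * ∫⁻ x in Ω, ‖fderiv ℝ v x‖ₑ ^ 2 := by
    calc ∫⁻ x in A, ‖v (x + w) - v x‖ₑ ^ 2
        ≤ ∫⁻ x in A, ‖w‖ₑ ^ 2 * ∫⁻ t in Icc (0 : ℝ) 1, ‖fderiv ℝ v (x + t • w)‖ₑ ^ 2 :=
          lintegral_mono fun x => enorm_sub_sq_le_lintegral isOpen_univ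
            (hv.contDiff.of_le (by simp)).contDiffOn x w (fun _ _ => mem_univ _)
      _ = ‖w‖ₑ ^ 2 * ∫⁻ t in Icc (0 : ℝ) 1, ∫⁻ x in A, ‖fderiv ℝ v (x + t • w)‖ₑ ^ 2 := by
          have hm : Measurable fun p : E × ℝ => ‖fderiv ℝ v (p.1 + p.2 • w)‖ₑ ^ 2 := by
            have : Continuous fun p : E × ℝ => fderiv ℝ v (p.1 + p.2 • w) := by fun_prop
            exact this.enorm.measurable.pow_const 2
          rw [lintegral_const_mul _ hm.lintegral_prod_right',
            lintegral_lintegral_swap hm.aemeasurable]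
      _ ≤ ‖w‖ₑ ^ 2 * ∫⁻ t in Icc (0 : ℝ) 1, ∫⁻ x in Ω, ‖fderiv ℝ v x‖ₑ ^ 2 := by
          refine mul_le_mul_right (setLIntegral_mono' measurableSet_Icc fun t ht => ?_) _
          exact hshift (F := fun y => ‖fderiv ℝ v y‖ₑ ^ 2) hA hΩ fun x hx => hw x (hAΩ hx) t ht
      _ = _ := by simp
  have hpt : ∀ x, ‖v x‖ₑ ^ 2 ≤ 2 * ‖v (x + w) - v x‖ₑ ^ 2 + 2 * ‖v (x + w)‖ₑ ^ 2 := by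
    intro x
    have h2 : (2 : ℝ≥0∞) = ENNReal.ofReal (2 : ℝ) := by simp
    simp only [Real.enorm_eq_ofReal_abs]
    rw [h2, ← ENNReal.ofReal_pow (abs_nonneg _), ← ENNReal.ofReal_pow (abs_nonneg _),
      ← ENNReal.ofReal_pow (abs_nonneg _), ← ENNReal.ofReal_mul zero_le_two,
      ← ENNReal.ofReal_mul zero_le_two, ← ENNReal.ofReal_add (by positivity) (by positivity)]
    apply ENNReal.ofReal_le_ofReal
    simp only [sq_abs]
    nlinarith [sq_nonneg (2 * v (x + w) - v x)]
  have hmain : ∫⁻ x in A, ‖v x‖ₑ ^ 2 ≤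
      2 * (‖w‖ₑ ^ 2 * ∫⁻ x in Ω, ‖fderiv ℝ v x‖ₑ ^ 2) + 2 * ∫⁻ x in B, ‖v x‖ₑ ^ 2 := by
    have m1 : Measurable fun x => ‖v (x + w) - v x‖ₑ ^ 2 := by
      have : Continuous fun x => v (x + w) - v x := by fun_prop
      exact this.enorm.measurable.pow_const 2
    have m2 : Measurable fun x => ‖v (x + w)‖ₑ ^ 2 := by
      have : Continuous fun x => v (x + w) := by fun_prop
      exact this.enorm.measurable.pow_const 2
    calc ∫⁻ x in A, ‖v x‖ₑ ^ 2
        ≤ ∫⁻ x in A, (2 * ‖v (x + w) - v x‖ₑ ^ 2 + 2 * ‖v (x + w)‖ₑ ^ 2) := lintegral_mono hpt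
      _ = 2 * (∫⁻ x in A, ‖v (x + w) - v x‖ₑ ^ 2) + 2 * ∫⁻ x in A, ‖v (x + w)‖ₑ ^ 2 := by
          rw [lintegral_add_left (m1.const_mul _), lintegral_const_mul _ m1,
            lintegral_const_mul _ m2]
      _ ≤ _ := by
          exact add_le_add (mul_le_mul_right hdiff _)
            (mul_le_mul_right (hshift (F := fun y => ‖v y‖ₑ ^ 2) hA hB hAB) _)
  have hI : 0 ≤ ∫ x in Ω, ‖fderiv ℝ v x‖ ^ 2 := integral_nonneg fun x => by positivity
  have hJ : 0 ≤ ∫ x in B, v x ^ 2 := integral_nonneg fun x => by positivity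
  have h2 : (2 : ℝ≥0∞) = ENNReal.ofReal (2 : ℝ) := by simp
  rw [hsq, hsq, hdsq, ← ofReal_norm, ← ENNReal.ofReal_pow (norm_nonneg _), h2,
    ← ENNReal.ofReal_mul (by positivity), ← ENNReal.ofReal_mul zero_le_two,
    ← ENNReal.ofReal_mul zero_le_two, ← ENNReal.ofReal_add (by positivity) (by positivity),
    ENNReal.ofReal_le_ofReal_iff (by positivity)] at hmain
  linarith

/-- The Rayleigh quotients of the Dirichlet problem in a bounded open set are bounded below by the
first eigenvalue. -/
theorem IsFirstDirichletEigenpair.rayleigh {ω : Set E} (hω : IsOpen ω)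
    (hωb : Bornology.IsBounded ω) {μ : ℝ} {φ : E → ℝ} {g : E → E}
    (h : IsFirstDirichletEigenpair ω μ φ g) {v : E → ℝ} (hv : IsAdmissible (frontier ω) v) :
    μ * ∫ x in ω, v x ^ 2 ≤ ∫ x in ω, ‖fderiv ℝ v x‖ ^ 2 := by
  by_contra! hlt
  obtain ⟨Λ, hΛ, hev, -⟩ := exists_isEigenvalue_lt μ ⟨v, hv, hlt⟩ (fun m _ => by
    have hm : 0 < |m| + 1 := by positivity
    obtain ⟨κ, hκ, f, hf⟩ := exists_finite_rank_bound (S := frontier ω) hω hωb subset_rfl one_pos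
      (fun x _ => inter_subset_right.trans subset_closure) (inv_pos.2 hm)
    refine ⟨κ, hκ, f, |m| + 1, fun v hv => ?_⟩
    have hs : 0 ≤ ∫ x in ω, v x ^ 2 := integral_nonneg fun x => by positivity
    have h1 := mul_le_mul_of_nonneg_left (hf v hv) hm.le
    rw [mul_add, mul_inv_cancel_left₀ hm.ne'] at h1
    refine le_trans ?_ h1
    have := le_abs_self m
    gcongr
    linarith)
  exact absurd (h.least Λ hev) (not_le.2 hΛ)

theorem IsEigenpair.integral_norm_sq {Ω S : Set E} {Λ : ℝ} {u : E → ℝ} {g : E → E}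
    (h : IsEigenpair Ω S Λ u g) : ∫ x in Ω, ‖g x‖ ^ 2 = Λ * ∫ x in Ω, u x ^ 2 := by
  have := h.identity u g h.mem
  simpa only [real_inner_self_eq_norm_sq, ← pow_two] using this

theorem IsEigenpair.nonneg {Ω S : Set E} {Λ : ℝ} {u : E → ℝ} {g : E → E}
    (h : IsEigenpair Ω S Λ u g) : 0 ≤ Λ := by
  have h1 := h.integral_norm_sq
  have h2 : 0 ≤ ∫ x in Ω, ‖g x‖ ^ 2 := integral_nonneg fun x => by positivity
  have h3 : 0 ≤ ∫ x in Ω, u x ^ 2 := integral_nonneg fun x => by positivity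
  rcases h3.eq_or_lt with h0 | h0
  · exfalso
    refine h.ne_zero ?_
    have := (integral_eq_zero_iff_of_nonneg (fun x => by positivity)
      h.mem.memLp_fun.integrable_sq).1 h0.symm
    filter_upwards [this] with x hx
    simpa using hx
  · by_contra! hneg
    nlinarith

theorem IsEigenpair.grad_ae_eq_zero {Ω S : Set E} {u : E → ℝ} {g : E → E}
    (h : IsEigenpair Ω S 0 u g) : g =ᵐ[volume.restrict Ω] 0 := by
  have h1 := h.integral_norm_sq
  rw [zero_mul] at h1
  have := (integral_eq_zero_iff_of_nonneg (fun x => by positivity)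
    (h.mem.memLp_grad.integrable_norm_pow (p := 2) (by norm_num))).1 h1
  filter_upwards [this] with x hx
  simpa using hx

/-- The first eigenvalue is positive as soon as the energy density `H (|∇φ|² - μ φ²)` does not have
zero integral: for `μ = 0` the gradient would vanish. -/
theorem IsEigenpair.pos_of_integral_neg {Ω S : Set E} {Λ : ℝ} {u : E → ℝ} {g : E → E}
    (h : IsEigenpair Ω S Λ u g) {H : E → ℝ}
    (hneg : ∫ x in Ω, H x * (‖g x‖ ^ 2 - Λ * u x ^ 2) < 0) : 0 < Λ := by
  rcases h.nonneg.eq_or_lt with h0 | h0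
  · subst h0
    have : ∫ x in Ω, H x * (‖g x‖ ^ 2 - 0 * u x ^ 2) = 0 := by
      refine integral_eq_zero_of_ae ?_
      filter_upwards [h.grad_ae_eq_zero] with x hx
      simp [hx]
    exact absurd hneg (by rw [this]; simp)
  · exact h0

end Bounds

/-! ### Geometry of the semi-infinite cylinder -/

section Geometry

open Filter Topology

variable {d : ℕ} {ω : Set (EuclideanSpace ℝ (Fin d))} {H : EuclideanSpace ℝ (Fin d) → ℝ}

theorem continuous_cylFst : Continuous (fun ξ : CylSpace d => ξ.fst) := WithLp.continuous_fst _ _ _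

theorem continuous_cylSnd : Continuous (fun ξ : CylSpace d => ξ.snd) := WithLp.continuous_snd _ _ _

theorem continuous_cylMk :
    Continuous (fun p : EuclideanSpace ℝ (Fin d) × ℝ => (WithLp.toLp 2 p : CylSpace d)) :=
  WithLp.prod_continuous_toLp 2 _ _

theorem isOpen_semiCylinder (hω : IsOpen ω) (hH : ContinuousOn H (closure ω)) :
    IsOpen (semiCylinder ω H) := by
  have h1 : IsOpen ((fun ξ : CylSpace d => ξ.fst) ⁻¹' ω) := hω.preimage continuous_cylFst
  have h2 : ContinuousOn (fun ξ : CylSpace d => ξ.snd + H ξ.fst) ((fun ξ => ξ.fst) ⁻¹' ω) :=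
    continuous_cylSnd.continuousOn.add
      ((hH.mono subset_closure).comp continuous_cylFst.continuousOn fun _ h => h)
  convert h2.isOpen_inter_preimage h1 (isOpen_Ioi (a := (0 : ℝ))) using 1
  ext ξ
  simp only [semiCylinder, mem_ofPred_eq, mem_inter_iff, mem_preimage, mem_Ioi]
  refine and_congr_right fun _ => ?_
  constructor <;> intro <;> linarith

/-- The compact layer over `closure ω` at height between `a` and `b` above the graph of `-H`. -/
theorem isCompact_layer (hωb : Bornology.IsBounded ω) (hH : ContinuousOn H (closure ω)) (a b : ℝ) :
    IsCompact {ξ : CylSpace d | ξ.fst ∈ closure ω ∧ ξ.snd + H ξ.fst ∈ Icc a b} := by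
  have hc : IsCompact (closure ω ×ˢ Icc a b) := hωb.isCompact_closure.prod isCompact_Icc
  have hf : ContinuousOn (fun p : EuclideanSpace ℝ (Fin d) × ℝ =>
      (WithLp.toLp 2 (p.1, p.2 - H p.1) : CylSpace d)) (closure ω ×ˢ Icc a b) :=
    continuous_cylMk.comp_continuousOn (continuousOn_fst.prodMk
      (continuousOn_snd.sub (hH.comp continuousOn_fst fun p hp => hp.1)))
  convert hc.image_of_continuousOn hf using 1
  ext ξ
  constructor
  · rintro ⟨h1, h2⟩
    refine ⟨(ξ.fst, ξ.snd + H ξ.fst), ⟨h1, h2⟩, ?_⟩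
    simp only [add_sub_cancel_right]
    rfl
  · rintro ⟨p, ⟨h1, h2⟩, rfl⟩
    exact ⟨h1, by simpa using h2⟩

theorem closure_curvedEnd_subset (hωb : Bornology.IsBounded ω) (hH : ContinuousOn H (closure ω)) :
    closure (curvedEnd ω H) ⊆ {ξ | ξ.fst ∈ closure ω ∧ ξ.snd + H ξ.fst ∈ Icc 0 0} := by
  refine closure_minimal ?_ (isCompact_layer hωb hH 0 0).isClosed
  rintro ξ ⟨h1, h2⟩
  exact ⟨subset_closure h1, by simp [h2]⟩

theorem frontier_semiCylinder_subset (hω : IsOpen ω) (hH : ContinuousOn H (closure ω)) :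
    frontier (semiCylinder ω H) ⊆ {ξ | ξ.fst ∈ frontier ω} ∪ curvedEnd ω H := by
  intro ξ hξ
  rw [(isOpen_semiCylinder hω hH).frontier_eq] at hξ
  have hcl : ξ.fst ∈ closure ω :=
    map_mem_closure (f := fun ξ : CylSpace d => ξ.fst) continuous_cylFst hξ.1 fun _ h => h.1
  by_cases hin : ξ.fst ∈ ω
  · refine Or.inr ⟨hin, le_antisymm ?_ ?_⟩
    · by_contra! hlt
      exact hξ.2 ⟨hin, hlt⟩
    · have hcont : ContinuousAt (fun ξ : CylSpace d => ξ.snd + H ξ.fst) ξ :=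
        continuous_cylSnd.continuousAt.add (ContinuousAt.comp (f := fun ξ : CylSpace d => ξ.fst)
          ((hH.mono subset_closure).continuousAt (hω.mem_nhds hin)) continuous_cylFst.continuousAt)
      by_contra! hlt
      have hev : ∀ᶠ y in 𝓝 ξ, (y.snd + H y.fst) < 0 :=
        hcont.eventually_lt continuousAt_const (by linarith)
      obtain ⟨y, hy, hy'⟩ := ((mem_closure_iff_frequently.1 hξ.1).and_eventually hev).exists
      linarith [hy.2]
  · exact Or.inl ⟨hcl, by rwa [hω.interior_eq]⟩

/-- The lateral side projects into the boundary of `ω`. -/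
theorem closure_lateralSide_subset (hω : IsOpen ω) (hH : ContinuousOn H (closure ω)) :
    closure (lateralSide ω H) ⊆ {ξ | ξ.fst ∈ frontier ω} := by
  refine closure_minimal (fun ξ hξ => ?_) (isClosed_frontier.preimage continuous_cylFst)
  exact (frontier_semiCylinder_subset hω hH hξ.1).resolve_right fun h => hξ.2 (subset_closure h)

/-- All points over the boundary of `ω` strictly above the graph of `-H` lie on the lateral side:
the closure of the curved end contains no further points over the boundary of `ω`. -/
theorem mem_lateralSide (hω : IsOpen ω) (hωb : Bornology.IsBounded ω)
    (hH : ContinuousOn H (closure ω)) {η : EuclideanSpace ℝ (Fin d)} (hη : η ∈ frontier ω) {ζ : ℝ}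
    (hζ : -H η < ζ) : (WithLp.toLp 2 (η, ζ) : CylSpace d) ∈ lateralSide ω H := by
  refine ⟨?_, fun h => ?_⟩
  · rw [(isOpen_semiCylinder hω hH).frontier_eq]
    refine ⟨?_, fun h => ?_⟩
    · have hηc : η ∈ closure ω := frontier_subset_closure hη
      have : (𝓝[ω] η).NeBot := mem_closure_iff_nhdsWithin_neBot.1 hηc
      have hlim : Tendsto (fun η' => (WithLp.toLp 2 (η', ζ) : CylSpace d)) (𝓝[ω] η)
          (𝓝 (WithLp.toLp 2 (η, ζ))) :=
        ((continuous_cylMk.comp (Continuous.prodMk_left ζ)).tendsto η).mono_left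
          nhdsWithin_le_nhds
      refine mem_closure_of_tendsto hlim ?_
      have hev : ∀ᶠ η' in 𝓝[ω] η, -H η' < ζ :=
        ((hH η hηc).mono subset_closure).neg.eventually_lt_const hζ
      filter_upwards [hev, self_mem_nhdsWithin] with η' h1 h2
      exact ⟨h2, h1⟩
    · rw [hω.frontier_eq] at hη
      exact hη.2 h.1
  · have := (closure_curvedEnd_subset hωb hH h).2
    simp at this
    linarith

theorem exists_abs_le (hωb : Bornology.IsBounded ω) (hH : ContinuousOn H (closure ω)) :
    ∃ M > 0, ∀ η ∈ closure ω, |H η| ≤ M := by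
  obtain ⟨C, hC⟩ := hωb.isCompact_closure.exists_bound_of_continuousOn hH
  exact ⟨max C 1, by positivity, fun η hη => (hC η hη).trans (le_max_left _ _)⟩

/-- The part of the semi-infinite cylinder above a layer of height `δ` and below the height `R`
stays away from the part of the boundary without Dirichlet condition. -/
theorem exists_ball_inter_frontier_subset (hωb : Bornology.IsBounded ω)
    (hH : ContinuousOn H (closure ω)) {δ R : ℝ} (hδ : 0 < δ) :
    ∃ r > 0, ∀ x ∈ {ξ : CylSpace d | ξ.fst ∈ ω ∧ ξ.snd + H ξ.fst ∈ Icc δ R},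
      Metric.ball x r ∩ frontier (semiCylinder ω H) ⊆ closure (lateralSide ω H) := by
  obtain ⟨r, hr, hsub⟩ := (isCompact_layer hωb hH δ R).exists_thickening_subset_open
    (isClosed_closure (s := curvedEnd ω H)).isOpen_compl (fun ξ hξ hξ' => by
      have h1 := hξ.2.1
      have h2 := (closure_curvedEnd_subset hωb hH hξ').2.2
      linarith)
  refine ⟨r, hr, fun x hx y hy => subset_closure ⟨hy.2, hsub ?_⟩⟩
  exact Metric.mem_thickening_iff.2 ⟨x, ⟨subset_closure hx.1, hx.2⟩, hy.1⟩

end Geometry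

/-! ### Horizontal slices -/

section Slices

open Filter Topology

variable {d : ℕ} {ω : Set (EuclideanSpace ℝ (Fin d))} {H : EuclideanSpace ℝ (Fin d) → ℝ}

theorem setIntegral_cylinder (s : Set (EuclideanSpace ℝ (Fin d) × ℝ)) (f : CylSpace d → ℝ) :
    ∫ ξ in WithLp.ofLp ⁻¹' s, f ξ = ∫ p in s, f (WithLp.toLp 2 p) :=
  (WithLp.volume_preserving_ofLp (U := EuclideanSpace ℝ (Fin d)) (V := ℝ)).setIntegral_preimage_emb
    (MeasurableEquiv.toLp 2 _).symm.measurableEmbedding (fun p => f (WithLp.toLp 2 p)) s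

theorem integrableOn_cylinder {s : Set (EuclideanSpace ℝ (Fin d) × ℝ)} {f : CylSpace d → ℝ}
    (hf : IntegrableOn f (WithLp.ofLp ⁻¹' s)) : IntegrableOn (fun p => f (WithLp.toLp 2 p)) s :=
  ((WithLp.volume_preserving_ofLp (U := EuclideanSpace ℝ (Fin d))
    (V := ℝ)).integrableOn_comp_preimage
    (MeasurableEquiv.toLp 2 _).symm.measurableEmbedding (f := fun p => f (WithLp.toLp 2 p))).1 hf

/-- The embedding of the cross-section at a given height. -/
noncomputable def sliceInl (d : ℕ) : EuclideanSpace ℝ (Fin d) →L[ℝ] CylSpace d :=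
  (WithLp.prodContinuousLinearEquiv 2 ℝ (EuclideanSpace ℝ (Fin d)) ℝ).symm.toContinuousLinearMap ∘L
    ContinuousLinearMap.inl ℝ _ _

theorem norm_sliceInl_le : ‖sliceInl d‖ ≤ 1 := by
  refine ContinuousLinearMap.opNorm_le_bound _ zero_le_one fun η => ?_
  rw [one_mul]
  have : ‖sliceInl d η‖ ^ 2 = ‖η‖ ^ 2 := by
    rw [WithLp.prod_norm_sq_eq_of_L2]
    simp [sliceInl]
  exact (pow_le_pow_iff_left₀ (norm_nonneg _) (norm_nonneg _) two_ne_zero).1 this.le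

theorem hasFDerivAt_slice (ζ : ℝ) (η : EuclideanSpace ℝ (Fin d)) :
    HasFDerivAt (fun η => (WithLp.toLp 2 (η, ζ) : CylSpace d)) (sliceInl d) η := by
  have h : HasFDerivAt (fun η : EuclideanSpace ℝ (Fin d) => (η, ζ))
      (ContinuousLinearMap.inl ℝ (EuclideanSpace ℝ (Fin d)) ℝ) η :=
    hasFDerivAt_prodMk_left η ζ
  exact ((WithLp.prodContinuousLinearEquiv 2 ℝ (EuclideanSpace ℝ (Fin d))
    ℝ).symm.hasFDerivAt).comp η h

theorem contDiff_slice (ζ : ℝ) :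
    ContDiff ℝ (⊤ : ℕ∞) (fun η : EuclideanSpace ℝ (Fin d) => (WithLp.toLp 2 (η, ζ) : CylSpace d)) :=
  (WithLp.prodContinuousLinearEquiv 2 ℝ (EuclideanSpace ℝ (Fin d)) ℝ).symm.contDiff.comp
    (contDiff_prodMk_left ζ)

theorem hasCompactSupport_slice {F : Type*} [Zero F] {f : CylSpace d → F}
    (hf : HasCompactSupport f) (ζ : ℝ) :
    HasCompactSupport (fun η : EuclideanSpace ℝ (Fin d) => f (WithLp.toLp 2 (η, ζ))) := by
  refine HasCompactSupport.intro (hf.isCompact.image continuous_cylFst) fun η hη => ?_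
  by_contra h
  exact hη ⟨_, subset_closure h, rfl⟩

/-- The slice of an admissible function at a height above the curved end satisfies the Dirichlet
condition on the boundary of the cross-section. -/
theorem IsAdmissible.slice (hω : IsOpen ω) (hωb : Bornology.IsBounded ω)
    (hH : ContinuousOn H (closure ω)) {v : CylSpace d → ℝ}
    (hv : IsAdmissible (lateralSide ω H) v) {ζ : ℝ} (hζ : ∀ η ∈ closure ω, -H η < ζ) :
    IsAdmissible (frontier ω) (fun η => v (WithLp.toLp 2 (η, ζ))) := by
  have hcont : Continuous (fun η : EuclideanSpace ℝ (Fin d) =>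
      (WithLp.toLp 2 (η, ζ) : CylSpace d)) := (contDiff_slice ζ).continuous
  refine ⟨hv.contDiff.comp (contDiff_slice ζ), hasCompactSupport_slice hv.hasCompactSupport ζ, ?_⟩
  · rw [isClosed_frontier.closure_eq, Set.disjoint_left]
    intro η hη hη'
    refine hv.disjoint.le_bot ⟨tsupport_comp_subset_preimage v hcont hη, subset_closure ?_⟩
    exact mem_lateralSide hω hωb hH hη' (hζ η (frontier_subset_closure hη'))

theorem IsAdmissible.norm_fderiv_slice_le {S : Set (CylSpace d)} {v : CylSpace d → ℝ}
    (hv : IsAdmissible S v) (η : EuclideanSpace ℝ (Fin d)) (ζ : ℝ) :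
    ‖fderiv ℝ (fun η => v (WithLp.toLp 2 (η, ζ))) η‖ ≤ ‖fderiv ℝ v (WithLp.toLp 2 (η, ζ))‖ := by
  have h := (hv.differentiable (WithLp.toLp 2 (η, ζ))).hasFDerivAt.comp η (hasFDerivAt_slice ζ η)
  have h' : fderiv ℝ (fun η => v (WithLp.toLp 2 (η, ζ))) η = _ := h.fderiv
  rw [h']
  refine (ContinuousLinearMap.opNorm_comp_le _ _).trans ?_
  exact mul_le_of_le_one_right (norm_nonneg _) norm_sliceInl_le

/-- Above the curved end the Dirichlet integral dominates `μ` times the `L²` norm. -/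
theorem IsAdmissible.setIntegral_upper_le (hω : IsOpen ω) (hωb : Bornology.IsBounded ω)
    (hH : ContinuousOn H (closure ω)) {v : CylSpace d → ℝ}
    (hv : IsAdmissible (lateralSide ω H) v) {μ : ℝ}
    (hμ : ∀ w, IsAdmissible (frontier ω) w →
      μ * ∫ x in ω, w x ^ 2 ≤ ∫ x in ω, ‖fderiv ℝ w x‖ ^ 2) {M : ℝ}
    (hM : ∀ η ∈ closure ω, -H η ≤ M) :
    μ * ∫ ξ in WithLp.ofLp ⁻¹' (ω ×ˢ Ioi M), v ξ ^ 2 ≤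
      ∫ ξ in WithLp.ofLp ⁻¹' (ω ×ˢ Ioi M), ‖fderiv ℝ v ξ‖ ^ 2 := by
  have i1 := integrableOn_cylinder (hv.integrable_sq (WithLp.ofLp ⁻¹' (ω ×ˢ Ioi M)))
  have i2 := integrableOn_cylinder (hv.integrable_fderiv_sq (WithLp.ofLp ⁻¹' (ω ×ˢ Ioi M)))
  rw [setIntegral_cylinder, setIntegral_cylinder]
  rw [IntegrableOn, Measure.volume_eq_prod, ← Measure.prod_restrict] at i1 i2
  rw [Measure.volume_eq_prod, ← Measure.prod_restrict, integral_prod_symm _ i1,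
    integral_prod_symm _ i2, ← integral_const_mul]
  refine setIntegral_mono_on (i1.integral_prod_right.const_mul μ) i2.integral_prod_right
    measurableSet_Ioi fun ζ hζ => ?_
  have hs : IsAdmissible (frontier ω) (fun η => v (WithLp.toLp 2 (η, ζ))) :=
    hv.slice hω hωb hH fun η hη => (hM η hη).trans_lt hζ
  refine (hμ _ hs).trans ?_
  have hint : IntegrableOn (fun η => ‖fderiv ℝ v (WithLp.toLp 2 (η, ζ))‖ ^ 2) ω := by
    have hc : Continuous (fun η => ‖fderiv ℝ v (WithLp.toLp 2 (η, ζ))‖ ^ 2) :=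
      (hv.continuous_fderiv.comp (contDiff_slice ζ).continuous).norm.pow 2
    refine (hc.integrable_of_hasCompactSupport ?_).integrableOn
    exact (hasCompactSupport_slice (hv.hasCompactSupport.fderiv (𝕜 := ℝ)) ζ).comp_left
      (g := fun L => ‖L‖ ^ 2) (by simp)
  refine integral_mono (hs.integrable_fderiv_sq ω) hint fun η => ?_
  have := hv.norm_fderiv_slice_le η ζ
  dsimp only
  gcongr

end Slices

/-! ### Inequalities in the semi-infinite cylinder -/

section Threshold

open Filter Topology

variable {d : ℕ} {ω : Set (EuclideanSpace ℝ (Fin d))} {H : EuclideanSpace ℝ (Fin d) → ℝ}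

/-- The vertical translation vector. -/
def vertical (d : ℕ) (T : ℝ) : CylSpace d := WithLp.toLp 2 (0, T)

theorem norm_vertical_sq (T : ℝ) : ‖vertical d T‖ ^ 2 = T ^ 2 := by
  rw [WithLp.prod_norm_sq_eq_of_L2]
  simp [vertical]

theorem add_vertical_fst (ξ : CylSpace d) (T : ℝ) : (ξ + vertical d T).fst = ξ.fst := by
  simp [vertical]

theorem add_vertical_snd (ξ : CylSpace d) (T : ℝ) :
    (ξ + vertical d T).snd = ξ.snd + T := by
  simp [vertical]

theorem smul_vertical (t T : ℝ) : t • vertical d T = vertical d (t * T) := by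
  simp [vertical, ← WithLp.toLp_smul]

theorem add_smul_vertical_mem {T : ℝ} (hT : 0 ≤ T) :
    ∀ ξ ∈ semiCylinder ω H, ∀ t ∈ Icc (0 : ℝ) 1, ξ + t • vertical d T ∈ semiCylinder ω H := by
  intro ξ hξ t ht
  rw [smul_vertical]
  refine ⟨by rw [add_vertical_fst]; exact hξ.1, ?_⟩
  have := hξ.2
  have : 0 ≤ t * T := mul_nonneg ht.1 hT
  simp only [add_vertical_fst, add_vertical_snd]
  linarith

theorem measurableSet_upper (hω : IsOpen ω) (M : ℝ) :
    MeasurableSet (WithLp.ofLp ⁻¹' (ω ×ˢ Ioi M) : Set (CylSpace d)) :=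
  ((hω.prod isOpen_Ioi).preimage (WithLp.prod_continuous_ofLp 2 _ _)).measurableSet

/-- Splitting the cylinder at the height `M`. The upper part satisfies the Poincaré inequality with
the constant of the cross-section. -/
theorem IsAdmissible.setIntegral_semiCylinder_le (hω : IsOpen ω) (hωb : Bornology.IsBounded ω)
    (hH : ContinuousOn H (closure ω)) {v : CylSpace d → ℝ}
    (hv : IsAdmissible (lateralSide ω H) v) {μ : ℝ}
    (hμ : ∀ w, IsAdmissible (frontier ω) w →
      μ * ∫ x in ω, w x ^ 2 ≤ ∫ x in ω, ‖fderiv ℝ w x‖ ^ 2) {M : ℝ}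
    (hM : ∀ η ∈ closure ω, |H η| ≤ M) :
    (∫ ξ in semiCylinder ω H, v ξ ^ 2 = (∫ ξ in semiCylinder ω H ∩ {ξ | ξ.snd ≤ M}, v ξ ^ 2) +
      ∫ ξ in WithLp.ofLp ⁻¹' (ω ×ˢ Ioi M), v ξ ^ 2) ∧
    μ * ∫ ξ in WithLp.ofLp ⁻¹' (ω ×ˢ Ioi M), v ξ ^ 2 ≤
      ∫ ξ in semiCylinder ω H, ‖fderiv ℝ v ξ‖ ^ 2 := by
  have hsub : (WithLp.ofLp ⁻¹' (ω ×ˢ Ioi M) : Set (CylSpace d)) ⊆ semiCylinder ω H :=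
    fun ξ hξ => ⟨hξ.1, (neg_le.1 (abs_le.1 (hM _ (subset_closure hξ.1))).1).trans_lt hξ.2⟩
  constructor
  · rw [← setIntegral_union ?_ (measurableSet_upper hω M) (hv.integrable_sq _)
      (hv.integrable_sq _)]
    · congr 2
      ext ξ
      refine ⟨fun h => ?_, ?_⟩
      · rcases le_or_gt ξ.snd M with h' | h'
        · exact Or.inl ⟨h, h'⟩
        · exact Or.inr ⟨h.1, h'⟩
      · rintro (h | h)
        · exact h.1
        · exact hsub h
    · exact Set.disjoint_left.2 fun ξ h h' => not_le.2 (show M < ξ.snd from h'.2) h.2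
  · refine (hv.setIntegral_upper_le hω hωb hH hμ fun η hη => ?_).trans
      (setIntegral_mono_set (hv.integrable_fderiv_sq _) (ae_of_all _ fun x => by positivity)
        hsub.eventuallyLE)
    exact neg_le.1 (abs_le.1 (hM η hη)).1

/-- The Poincaré inequality in the semi-infinite cylinder. -/
theorem exists_poincare_const (hω : IsOpen ω) (hωb : Bornology.IsBounded ω)
    (hH : ContinuousOn H (closure ω)) {μ : ℝ} (hμ0 : 0 < μ)
    (hμ : ∀ w, IsAdmissible (frontier ω) w →
      μ * ∫ x in ω, w x ^ 2 ≤ ∫ x in ω, ‖fderiv ℝ w x‖ ^ 2) :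
    ∃ c > 0, ∀ v, IsAdmissible (lateralSide ω H) v →
      c * ∫ ξ in semiCylinder ω H, v ξ ^ 2 ≤ ∫ ξ in semiCylinder ω H, ‖fderiv ℝ v ξ‖ ^ 2 := by
  obtain ⟨M, hM0, hM⟩ := exists_abs_le hωb hH
  -- a shift by `T` moves the part below the height `M` into the part above it
  set T := 2 * M + 1
  refine ⟨(2 * T ^ 2 + 3 / μ)⁻¹, by positivity, fun v hv => ?_⟩
  obtain ⟨h1, h2⟩ := hv.setIntegral_semiCylinder_le hω hωb hH hμ hM
  have hm := (isOpen_semiCylinder hω hH).measurableSet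
  have h3 := hv.setIntegral_sq_le_shift (A := semiCylinder ω H ∩ {ξ | ξ.snd ≤ M})
    (w := vertical d T) hm
    (hm.inter (measurableSet_le continuous_cylSnd.measurable measurable_const))
    (measurableSet_upper hω M) inter_subset_left (add_smul_vertical_mem (by positivity))
    (fun ξ hξ => by
      have := hξ.1.2
      have := (abs_le.1 (hM _ (subset_closure hξ.1.1))).2
      refine ⟨?_, ?_⟩
      · change (ξ + vertical d T).fst ∈ ω
        rw [add_vertical_fst]; exact hξ.1.1
      · change M < (ξ + vertical d T).snd
        rw [add_vertical_snd]
        linarith)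
  rw [norm_vertical_sq] at h3
  rw [inv_mul_le_iff₀ (by positivity), h1]
  set a := ∫ ξ in WithLp.ofLp ⁻¹' (ω ×ˢ Ioi M), v ξ ^ 2
  set I := ∫ ξ in semiCylinder ω H, ‖fderiv ℝ v ξ‖ ^ 2
  have ha : a ≤ I / μ := by rw [le_div_iff₀ hμ0]; linarith
  have e : (2 * T ^ 2 + 3 / μ) * I = 2 * T ^ 2 * I + 3 * (I / μ) := by ring
  linarith

/-- Below the threshold `μ` the Rayleigh quotients in the semi-infinite cylinder are controlled up
to a finite rank form: the part of the cylinder above the height `M` contributes at least `μ`, the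
part below is, after a small vertical shift, at a positive distance from the curved end. -/
theorem exists_finite_rank_bound_semiCylinder (hω : IsOpen ω) (hωb : Bornology.IsBounded ω)
    (hH : ContinuousOn H (closure ω)) {μ : ℝ} (hμ0 : 0 < μ)
    (hμ : ∀ w, IsAdmissible (frontier ω) w →
      μ * ∫ x in ω, w x ^ 2 ≤ ∫ x in ω, ‖fderiv ℝ w x‖ ^ 2) {m : ℝ} (hm : m < μ) :
    ∃ (κ : Type) (_ : Fintype κ) (f : κ → Lp ℝ 2 (volume.restrict (semiCylinder ω H))) (C : ℝ),
      ∀ v, IsAdmissible (lateralSide ω H) v →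
        m * ∫ ξ in semiCylinder ω H, v ξ ^ 2 ≤
          (∫ ξ in semiCylinder ω H, ‖fderiv ℝ v ξ‖ ^ 2) +
            C * ∑ i, (∫ ξ in semiCylinder ω H, f i ξ * v ξ) ^ 2 := by
  obtain ⟨M, hM0, hM⟩ := exists_abs_le hωb hH
  -- a positive level is needed below, and raising `m` only strengthens the claim
  set m' := max m (μ / 2)
  have hm'0 : 0 < m' := lt_max_of_lt_right (by positivity)
  have hm'μ : m' < μ := max_lt hm (by linarith)
  have hθ : 0 < 1 - m' / μ := by rw [sub_pos, div_lt_one hμ0]; exact hm'μ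
  set δ := Real.sqrt ((1 - m' / μ) / (4 * m')) with hδdef
  have hδ : 0 < δ := Real.sqrt_pos.2 (by positivity)
  -- this choice of `δ` makes the coefficient of the Dirichlet integral equal to `1` in the end
  have hδ2 : 4 * m' * δ ^ 2 = 1 - m' / μ := by
    rw [hδdef, Real.sq_sqrt (by positivity), mul_div_cancel₀ _ (by positivity)]
  have hP := isOpen_semiCylinder hω hH
  -- the lower part of the cylinder, shifted upwards by `δ`
  set K : Set (CylSpace d) := {ξ | ξ.fst ∈ ω ∧ ξ.snd + H ξ.fst ∈ Icc δ (2 * M + δ)} with hKdef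
  have hKP : K ⊆ semiCylinder ω H := fun ξ hξ => ⟨hξ.1, by have := hξ.2.1; linarith⟩
  have hKb : Bornology.IsBounded K := (isCompact_layer hωb hH δ (2 * M + δ)).isBounded.subset
    fun ξ hξ => ⟨subset_closure hξ.1, hξ.2⟩
  have hKm : MeasurableSet K := by
    have : K = ((fun ξ : CylSpace d => ξ.fst) ⁻¹' ω) ∩
        {ξ | ξ.fst ∈ closure ω ∧ ξ.snd + H ξ.fst ∈ Icc δ (2 * M + δ)} := by
      ext ξ
      exact ⟨fun h => ⟨h.1, subset_closure h.1, h.2⟩, fun h => ⟨h.1, h.2.2⟩⟩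
    rw [this]
    exact (hω.preimage continuous_cylFst).measurableSet.inter
      (isCompact_layer hωb hH δ (2 * M + δ)).isClosed.measurableSet
  obtain ⟨r, hr, hball⟩ := exists_ball_inter_frontier_subset (R := 2 * M + δ) hωb hH hδ
  obtain ⟨κ, hκ, f, hf⟩ := exists_finite_rank_bound hP hKb hKP hr hball (ε := δ ^ 2) (by positivity)
  refine ⟨κ, hκ, f, 2 * m', fun v hv => ?_⟩
  obtain ⟨h1, h2⟩ := hv.setIntegral_semiCylinder_le hω hωb hH hμ hM
  have h3 := hv.setIntegral_sq_le_shift (w := vertical d δ) hP.measurableSet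
    (hP.measurableSet.inter (measurableSet_le continuous_cylSnd.measurable measurable_const))
    hKm inter_subset_left (add_smul_vertical_mem hδ.le)
    (A := semiCylinder ω H ∩ {ξ | ξ.snd ≤ M}) (fun ξ hξ => by
      have a1 := hξ.1.2
      have a2 : ξ.snd ≤ M := hξ.2
      have a3 := (abs_le.1 (hM _ (subset_closure hξ.1.1))).2
      refine ⟨by rw [add_vertical_fst]; exact hξ.1.1, ?_⟩
      rw [add_vertical_snd, add_vertical_fst]
      constructor <;> linarith)
  rw [norm_vertical_sq] at h3
  have h4 := hf v hv
  set a := ∫ ξ in WithLp.ofLp ⁻¹' (ω ×ˢ Ioi M), v ξ ^ 2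
  set I := ∫ ξ in semiCylinder ω H, ‖fderiv ℝ v ξ‖ ^ 2
  set σ := ∑ i, (∫ ξ in semiCylinder ω H, f i ξ * v ξ) ^ 2
  have ha : a ≤ I / μ := by rw [le_div_iff₀ hμ0]; linarith
  have hs : 0 ≤ ∫ ξ in semiCylinder ω H, v ξ ^ 2 := integral_nonneg fun x => by positivity
  calc m * ∫ ξ in semiCylinder ω H, v ξ ^ 2
      ≤ m' * ∫ ξ in semiCylinder ω H, v ξ ^ 2 := by gcongr; exact le_max_left _ _
    _ ≤ m' * (4 * δ ^ 2 * I + 2 * σ + I / μ) := by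
        gcongr
        rw [h1]
        linarith
    _ = (4 * m' * δ ^ 2 + m' / μ) * I + 2 * m' * σ := by ring
    _ = I + 2 * m' * σ := by rw [hδ2]; ring

end Threshold

/-! ### Ingredients of the trial function -/

section TrialFunction

open Filter Topology

/-- Continuity of weighted quadratic functionals on `L²`, for bounded weights. -/
theorem exists_eLpNorm_sub_le_imp {α F : Type*} [MeasurableSpace α] {ν : Measure α}
    [NormedAddCommGroup F] [InnerProductSpace ℝ F] {f : α → F} (hf : MemLp f 2 ν) {k : α → ℝ}
    (hk : AEStronglyMeasurable k ν) {B : ℝ} (hB : 0 ≤ B) (hkB : ∀ᵐ x ∂ν, |k x| ≤ B) {ε : ℝ}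
    (hε : 0 < ε) :
    ∃ δ : ℝ≥0∞, 0 < δ ∧ ∀ f' : α → F, MemLp f' 2 ν → eLpNorm (fun x => f' x - f x) 2 ν ≤ δ →
      |∫ x, k x * ‖f' x‖ ^ 2 ∂ν - ∫ x, k x * ‖f x‖ ^ 2 ∂ν| ≤ ε := by
  set s := ∫ x, ‖f x‖ ^ 2 ∂ν
  have hs : 0 ≤ s := integral_nonneg fun x => by positivity
  obtain ⟨τ, hτ, hτε⟩ : ∃ τ > 0, B * (τ * s) ≤ ε / 2 := by
    refine ⟨ε / 2 / (B * s + 1), by positivity, ?_⟩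
    rw [show B * (ε / 2 / (B * s + 1) * s) = ε / 2 * (B * s / (B * s + 1)) by ring]
    refine mul_le_of_le_one_right (by positivity) ?_
    rw [div_le_one (by positivity)]
    linarith
  set δ := Real.sqrt (ε / 2 / (B * (1 + 1 / τ) + 1)) with hδdef
  have hδ : 0 < δ := Real.sqrt_pos.2 (by positivity)
  have hδ2 : δ ^ 2 = ε / 2 / (B * (1 + 1 / τ) + 1) := Real.sq_sqrt (by positivity)
  refine ⟨ENNReal.ofReal δ, by simpa using hδ, fun f' hf' hle => ?_⟩
  have hd : MemLp (fun x => f' x - f x) 2 ν := hf'.sub hf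
  have hdn : ∫ x, ‖f' x - f x‖ ^ 2 ∂ν ≤ δ ^ 2 := by
    rw [← norm_sq_eq_integral hd.toLp hd.coeFn_toLp, Lp.norm_toLp]
    gcongr
    exact ENNReal.toReal_le_of_le_ofReal hδ.le hle
  have i0 := hf.integrable_norm_pow (p := 2) (by norm_num)
  have i1 := hf'.integrable_norm_pow (p := 2) (by norm_num)
  have i2 := hd.integrable_norm_pow (p := 2) (by norm_num)
  have j0 : Integrable (fun x => k x * ‖f x‖ ^ 2) ν := i0.bdd_mul hk (c := B) hkB
  have j1 : Integrable (fun x => k x * ‖f' x‖ ^ 2) ν := i1.bdd_mul hk (c := B) hkB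
  rw [← integral_sub j1 j0]
  have i3 : Integrable (fun x => B * (τ * ‖f x‖ ^ 2 + (1 + 1 / τ) * ‖f' x - f x‖ ^ 2)) ν :=
    ((i0.const_mul τ).add (i2.const_mul (1 + 1 / τ))).const_mul B
  calc |∫ x, (k x * ‖f' x‖ ^ 2 - k x * ‖f x‖ ^ 2) ∂ν|
      ≤ ∫ x, |k x * ‖f' x‖ ^ 2 - k x * ‖f x‖ ^ 2| ∂ν := abs_integral_le_integral_abs
    _ ≤ ∫ x, B * (τ * ‖f x‖ ^ 2 + (1 + 1 / τ) * ‖f' x - f x‖ ^ 2) ∂ν := by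
        refine integral_mono_ae (j1.sub j0).abs i3 ?_
        filter_upwards [hkB] with x hx
        rw [← mul_sub, abs_mul]
        gcongr
        have h1 : |‖f' x‖ - ‖f x‖| ≤ ‖f' x - f x‖ := abs_norm_sub_norm_le _ _
        have h2 : ‖f' x‖ ≤ ‖f x‖ + ‖f' x - f x‖ := by linarith [(abs_le.1 h1).2]
        set a := ‖f x‖
        set b := ‖f' x - f x‖
        have ha : 0 ≤ a := norm_nonneg _
        have hb : 0 ≤ b := norm_nonneg _
        -- Young's inequality with the parameter `τ`
        have hyoung : 2 * (a * b) ≤ τ * a ^ 2 + 1 / τ * b ^ 2 := by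
          have : 0 ≤ (τ * a - b) ^ 2 / τ := by positivity
          have e : (τ * a - b) ^ 2 / τ = τ * a ^ 2 + 1 / τ * b ^ 2 - 2 * (a * b) := by
            field_simp; ring
          linarith
        have h3 : |‖f' x‖ ^ 2 - a ^ 2| ≤ b * (2 * a + b) := by
          rw [sq_sub_sq, mul_comm, abs_mul]
          refine mul_le_mul h1 ?_ (abs_nonneg _) hb
          rw [abs_of_nonneg (by positivity)]
          linarith
        nlinarith
    _ = B * (τ * s + (1 + 1 / τ) * ∫ x, ‖f' x - f x‖ ^ 2 ∂ν) := by
        rw [integral_const_mul, integral_add (i0.const_mul τ) (i2.const_mul (1 + 1 / τ)),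
          integral_const_mul, integral_const_mul]
    _ ≤ B * (τ * s + (1 + 1 / τ) * δ ^ 2) := by gcongr
    _ = B * (τ * s) + ε / 2 * (B * (1 + 1 / τ) / (B * (1 + 1 / τ) + 1)) := by rw [hδ2]; ring
    _ ≤ ε / 2 + ε / 2 := by
        gcongr
        refine mul_le_of_le_one_right (by positivity) ?_
        rw [div_le_one (by positivity)]
        linarith
    _ = ε := by ring

/-- A smooth cutoff function on the line with a long plateau and a small Dirichlet integral. -/
theorem exists_cutoff (M : ℝ) {κ : ℝ} (hκ : 0 < κ) :
    ∃ χ : ℝ → ℝ, ContDiff ℝ (⊤ : ℕ∞) χ ∧ HasCompactSupport χ ∧ (∀ ζ, |ζ| ≤ M → χ ζ = 1) ∧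
      ∫ ζ, deriv χ ζ ^ 2 ≤ κ := by
  let θ : ContDiffBump (0 : ℝ) := ⟨1, 2, one_pos, one_lt_two⟩
  set D := ∫ ζ, deriv θ ζ ^ 2
  have hD : 0 ≤ D := integral_nonneg fun x => by positivity
  set N := max 1 (max M (D / κ)) with hN
  have hN0 : 0 < N := lt_max_of_lt_left one_pos
  refine ⟨fun ζ => θ (N⁻¹ * ζ), θ.contDiff.comp (contDiff_const.mul contDiff_id), ?_, ?_, ?_⟩
  · refine HasCompactSupport.intro (isCompact_Icc (a := -(2 * N)) (b := 2 * N)) fun ζ hζ => ?_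
    refine θ.zero_of_le_dist ?_
    change 2 ≤ dist (N⁻¹ * ζ) 0
    rw [dist_zero_right, norm_mul, norm_inv, Real.norm_of_nonneg hN0.le, Real.norm_eq_abs,
      le_inv_mul_iff₀ hN0]
    by_contra! h
    exact hζ (abs_le.1 (by linarith))
  · intro ζ hζ
    refine θ.one_of_mem_closedBall ?_
    rw [mem_closedBall_zero_iff, norm_mul, norm_inv, Real.norm_of_nonneg hN0.le, Real.norm_eq_abs]
    change N⁻¹ * |ζ| ≤ 1
    rw [inv_mul_le_iff₀ hN0, mul_one]
    exact hζ.trans ((le_max_left _ _).trans (le_max_right _ _))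
  · have hder : ∀ ζ, deriv (fun ζ => θ (N⁻¹ * ζ)) ζ ^ 2 = N⁻¹ ^ 2 * deriv θ (N⁻¹ * ζ) ^ 2 := by
      intro ζ
      rw [deriv_comp_mul_left, smul_eq_mul, mul_pow]
    simp only [hder]
    rw [integral_const_mul, Measure.integral_comp_mul_left (fun x => deriv θ x ^ 2), inv_inv,
      abs_of_pos hN0, smul_eq_mul]
    have h1 : D / κ ≤ N := (le_max_right _ _).trans (le_max_right _ _)
    rw [div_le_iff₀ hκ] at h1
    change N⁻¹ ^ 2 * (N * D) ≤ κ
    rw [pow_two, mul_assoc, inv_mul_cancel_left₀ hN0.ne', inv_mul_le_iff₀ hN0]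
    exact h1

variable {d : ℕ} {ω : Set (EuclideanSpace ℝ (Fin d))} {H : EuclideanSpace ℝ (Fin d) → ℝ}

/-- Iterated integration over the semi-infinite cylinder. -/
theorem setIntegral_semiCylinder (hω : IsOpen ω) (hH : ContinuousOn H (closure ω))
    {f : CylSpace d → ℝ} (hf : Integrable f) :
    IntegrableOn (fun η => ∫ ζ in Ioi (-H η), f (WithLp.toLp 2 (η, ζ))) ω ∧
    ∫ ξ in semiCylinder ω H, f ξ = ∫ η in ω, ∫ ζ in Ioi (-H η), f (WithLp.toLp 2 (η, ζ)) := by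
  set s : Set (EuclideanSpace ℝ (Fin d) × ℝ) := {p | p.1 ∈ ω ∧ -H p.1 < p.2}
  have hs : MeasurableSet s :=
    ((isOpen_semiCylinder hω hH).preimage continuous_cylMk).measurableSet
  have hi : IntegrableOn (fun p => f (WithLp.toLp 2 p)) s :=
    integrableOn_cylinder hf.integrableOn
  have hi' : Integrable (s.indicator fun p => f (WithLp.toLp 2 p)) := hi.integrable_indicator hs
  have hinner : ∀ η, ∫ ζ, s.indicator (fun p => f (WithLp.toLp 2 p)) (η, ζ) =
      ω.indicator (fun η => ∫ ζ in Ioi (-H η), f (WithLp.toLp 2 (η, ζ))) η := by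
    intro η
    by_cases hη : η ∈ ω
    · rw [indicator_of_mem hη, ← integral_indicator measurableSet_Ioi]
      refine integral_congr_ae (ae_of_all _ fun ζ => ?_)
      by_cases hζ : -H η < ζ
      · simp [indicator, s, hη, hζ]
      · simp [indicator, s, hζ]
    · rw [indicator_of_notMem hη]
      simp [indicator, s, hη]
  constructor
  · rw [← integrable_indicator_iff hω.measurableSet]
    have := Integrable.integral_prod_left hi'
    simpa only [hinner] using this
  · change ∫ ξ in WithLp.ofLp ⁻¹' s, f ξ = _
    rw [setIntegral_cylinder, ← integral_indicator hs, Measure.volume_eq_prod,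
      integral_prod _ hi']
    simp only [hinner]
    rw [integral_indicator hω.measurableSet]

theorem fderiv_mul_apply {E : Type*} [NormedAddCommGroup E] [NormedSpace ℝ E] {f g : E → ℝ}
    {f' g' : E →L[ℝ] ℝ} {x : E} (hf : HasFDerivAt f f' x) (hg : HasFDerivAt g g' x) (h : E) :
    fderiv ℝ (fun y => f y * g y) x h = f x * g' h + g x * f' h := by
  rw [(hf.fun_mul hg).fderiv]
  simp

theorem norm_fderiv_mul_sq_le {v : EuclideanSpace ℝ (Fin d) → ℝ} (hv : Differentiable ℝ v)
    {χ : ℝ → ℝ} (hχ : Differentiable ℝ χ) (ξ : CylSpace d) :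
    ‖fderiv ℝ (fun ξ : CylSpace d => v ξ.fst * χ ξ.snd) ξ‖ ^ 2 ≤
      ‖fderiv ℝ v ξ.fst‖ ^ 2 * χ ξ.snd ^ 2 + v ξ.fst ^ 2 * deriv χ ξ.snd ^ 2 := by
  let P₁ : CylSpace d →L[ℝ] EuclideanSpace ℝ (Fin d) := WithLp.fstL 2 ℝ _ _
  let P₂ : CylSpace d →L[ℝ] ℝ := WithLp.sndL 2 ℝ _ _
  have h1 : HasFDerivAt (fun ξ : CylSpace d => v ξ.fst) ((fderiv ℝ v ξ.fst).comp P₁) ξ :=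
    HasFDerivAt.comp (g := v) (f := P₁) ξ (hv ξ.fst).hasFDerivAt P₁.hasFDerivAt
  have h2 : HasFDerivAt (fun ξ : CylSpace d => χ ξ.snd) (deriv χ ξ.snd • P₂) ξ :=
    HasDerivAt.comp_hasFDerivAt (h₂ := χ) (f := P₂) ξ (hχ ξ.snd).hasDerivAt P₂.hasFDerivAt
  set a := ‖fderiv ℝ v ξ.fst‖ * |χ ξ.snd| with ha
  set b := |v ξ.fst| * |deriv χ ξ.snd| with hb
  have hab : ‖fderiv ℝ v ξ.fst‖ ^ 2 * χ ξ.snd ^ 2 + v ξ.fst ^ 2 * deriv χ ξ.snd ^ 2 =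
      a ^ 2 + b ^ 2 := by
    rw [ha, hb, mul_pow, mul_pow, sq_abs, sq_abs, sq_abs]
  rw [hab]
  refine (Real.le_sqrt (norm_nonneg _) (by positivity)).1 ?_
  refine ContinuousLinearMap.opNorm_le_bound _ (Real.sqrt_nonneg _) fun h => ?_
  have hle : ‖fderiv ℝ v ξ.fst h.fst‖ ≤ ‖fderiv ℝ v ξ.fst‖ * ‖h.fst‖ :=
    ContinuousLinearMap.le_opNorm _ _
  have hn : ‖h‖ ^ 2 = ‖h.fst‖ ^ 2 + ‖h.snd‖ ^ 2 := WithLp.prod_norm_sq_eq_of_L2 h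
  have hbound : |v ξ.fst * (h.snd * deriv χ ξ.snd) + χ ξ.snd * fderiv ℝ v ξ.fst h.fst| ≤
      a * ‖h.fst‖ + b * ‖h.snd‖ := by
    refine (abs_add_le _ _).trans ?_
    rw [abs_mul, abs_mul, abs_mul]
    simp only [Real.norm_eq_abs] at hle ⊢
    have : |χ ξ.snd| * |fderiv ℝ v ξ.fst h.fst| ≤
      |χ ξ.snd| * (‖fderiv ℝ v ξ.fst‖ * ‖h.fst‖) := by gcongr
    rw [ha, hb]
    linarith
  have hcs : a * ‖h.fst‖ + b * ‖h.snd‖ ≤ Real.sqrt (a ^ 2 + b ^ 2) * ‖h‖ := by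
    rw [← Real.sqrt_sq (norm_nonneg h), ← Real.sqrt_mul (by positivity), hn]
    refine Real.le_sqrt_of_sq_le ?_
    nlinarith [sq_nonneg (a * ‖h.snd‖ - b * ‖h.fst‖)]
  refine le_trans (le_of_eq ?_) (hbound.trans hcs)
  rw [fderiv_mul_apply h1 h2, Real.norm_eq_abs, mul_comm h.snd]
  rfl

end TrialFunction

/-! ### The trial function -/

section TrialFunctionCylinder

open Filter Topology

variable {d : ℕ} {ω : Set (EuclideanSpace ℝ (Fin d))} {H : EuclideanSpace ℝ (Fin d) → ℝ}

theorem IsAdmissible.mul_cutoff (hω : IsOpen ω) (hH : ContinuousOn H (closure ω))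
    {v : EuclideanSpace ℝ (Fin d) → ℝ} (hv : IsAdmissible (frontier ω) v) {χ : ℝ → ℝ}
    (hχ : ContDiff ℝ (⊤ : ℕ∞) χ) (hχc : HasCompactSupport χ) :
    IsAdmissible (lateralSide ω H) (fun ξ : CylSpace d => v ξ.fst * χ ξ.snd) := by
  have e : ContDiff ℝ (⊤ : ℕ∞) (fun ξ : CylSpace d => ξ.ofLp) :=
    (WithLp.prodContinuousLinearEquiv 2 ℝ (EuclideanSpace ℝ (Fin d)) ℝ).contDiff
  refine ⟨(hv.contDiff.comp (contDiff_fst.comp e)).mul (hχ.comp (contDiff_snd.comp e)), ?_, ?_⟩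
  · refine HasCompactSupport.intro
      ((hv.hasCompactSupport.isCompact.prod hχc.isCompact).image continuous_cylMk) fun ξ hξ => ?_
    by_contra h
    have h1 : ξ.fst ∈ tsupport v := subset_closure (left_ne_zero_of_mul h)
    have h2 : ξ.snd ∈ tsupport χ := subset_closure (right_ne_zero_of_mul h)
    exact hξ ⟨(ξ.fst, ξ.snd), ⟨h1, h2⟩, rfl⟩
  · have h1 : tsupport (fun ξ : CylSpace d => v ξ.fst * χ ξ.snd) ⊆
        (fun ξ : CylSpace d => ξ.fst) ⁻¹' tsupport v :=
      (tsupport_mul_subset_left (f := fun ξ : CylSpace d => v ξ.fst)).trans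
        (tsupport_comp_subset_preimage v continuous_cylFst)
    rw [Set.disjoint_left]
    intro ξ hξ hξ'
    exact hv.disjoint.le_bot ⟨h1 hξ, subset_closure (closure_lateralSide_subset hω hH hξ')⟩

theorem setIntegral_Ioi_sq_of_plateau {χ : ℝ → ℝ} (hχ : Continuous χ) (hχc : HasCompactSupport χ)
    {M : ℝ} (h1 : ∀ ζ, |ζ| ≤ M → χ ζ = 1) {a : ℝ} (ha : |a| ≤ M) :
    ∫ ζ in Ioi (-a), χ ζ ^ 2 = a + ∫ ζ in Ioi 0, χ ζ ^ 2 := by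
  have hM : 0 ≤ M := (abs_nonneg a).trans ha
  have hi : Integrable (fun ζ => χ ζ ^ 2) :=
    (hχ.memLp_of_hasCompactSupport (p := 2) hχc).integrable_sq
  -- compare with the integral from the left end of the plateau, where `χ² = 1`
  have key : ∀ b, |b| ≤ M →
      (∫ ζ in Ioi (-M), χ ζ ^ 2) - ∫ ζ in Ioi b, χ ζ ^ 2 = b + M := fun b hb => by
    have hb' := abs_le.1 hb
    rw [intervalIntegral.integral_Ioi_sub_Ioi hi.integrableOn hb'.1]
    have : ∫ ζ in (-M)..b, χ ζ ^ 2 = ∫ ζ in (-M)..b, (1 : ℝ) := by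
      refine intervalIntegral.integral_congr fun ζ hζ => ?_
      rw [uIcc_of_le hb'.1] at hζ
      rw [h1 ζ (abs_le.2 ⟨hζ.1, hζ.2.trans hb'.2⟩), one_pow]
    rw [this]
    simp
  have e1 := key (-a) (by rwa [abs_neg])
  have e2 := key 0 (by simpa using hM)
  linarith

/-- The Rayleigh form of the product `v(η) χ(ζ)`, where `χ = 1` on the range of `-H`. For fixed `η`
the integral of `χ²` over `ζ > -H(η)` is exactly `H(η) + c`, so that the weight `H` appears. -/
theorem IsAdmissible.rayleigh_mul_cutoff_le (hω : IsOpen ω) (hH : ContinuousOn H (closure ω))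
    {M : ℝ} (hM : ∀ η ∈ closure ω, |H η| ≤ M)
    {v : EuclideanSpace ℝ (Fin d) → ℝ} (hv : IsAdmissible (frontier ω) v) {χ : ℝ → ℝ}
    (hχ : ContDiff ℝ (⊤ : ℕ∞) χ) (hχc : HasCompactSupport χ) (hχ1 : ∀ ζ, |ζ| ≤ M → χ ζ = 1)
    {κ : ℝ} (hκ : ∫ ζ, deriv χ ζ ^ 2 ≤ κ) (μ : ℝ) :
    (∫ ξ in semiCylinder ω H, ‖fderiv ℝ (fun ξ : CylSpace d => v ξ.fst * χ ξ.snd) ξ‖ ^ 2) -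
        μ * ∫ ξ in semiCylinder ω H, (v ξ.fst * χ ξ.snd) ^ 2 ≤
      (∫ η in ω, (H η + ∫ ζ in Ioi 0, χ ζ ^ 2) * ‖fderiv ℝ v η‖ ^ 2) +
        ∫ η in ω, (κ - μ * (H η + ∫ ζ in Ioi 0, χ ζ ^ 2)) * v η ^ 2 := by
  set c := ∫ ζ in Ioi 0, χ ζ ^ 2
  have hW := hv.mul_cutoff (H := H) hω hH hχ hχc
  have hcχ := hχ.continuous
  have hcχ' : Continuous (deriv χ) := hχ.continuous_deriv (by simp)
  have hχ'c : HasCompactSupport (deriv χ) := hχc.deriv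
  have hcv := hv.contDiff.continuous
  have hcdv := hv.continuous_fderiv
  let f : CylSpace d → ℝ := fun ξ => (‖fderiv ℝ v ξ.fst‖ ^ 2 * χ ξ.snd ^ 2 +
    v ξ.fst ^ 2 * deriv χ ξ.snd ^ 2) - μ * (v ξ.fst * χ ξ.snd) ^ 2
  have hf : Integrable f := by
    have hc : Continuous f := by
      have h1 := continuous_cylFst (d := d)
      have h2 := continuous_cylSnd (d := d)
      have a1 := hcdv.comp h1
      have a2 := hcv.comp h1
      have a3 := hcχ.comp h2
      have a4 := hcχ'.comp h2
      exact (((a1.norm.pow 2).mul (a3.pow 2)).add ((a2.pow 2).mul (a4.pow 2))).sub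
        (continuous_const.mul ((a2.mul a3).pow 2))
    refine hc.integrable_of_hasCompactSupport ?_
    refine HasCompactSupport.intro
      ((hv.hasCompactSupport.isCompact.prod hχc.isCompact).image continuous_cylMk) fun ξ hξ => ?_
    have hcase : ξ.fst ∉ tsupport v ∨ ξ.snd ∉ tsupport χ := by
      by_contra! h
      exact hξ ⟨(ξ.fst, ξ.snd), h, rfl⟩
    rcases hcase with h | h
    · have z1 : v ξ.fst = 0 := image_eq_zero_of_notMem_tsupport h
      have z2 : fderiv ℝ v ξ.fst = 0 := image_eq_zero_of_notMem_tsupport fun h' =>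
        h (tsupport_fderiv_subset ℝ h')
      simp [f, z1, z2]
    · have z1 : χ ξ.snd = 0 := image_eq_zero_of_notMem_tsupport h
      have z2 : deriv χ ξ.snd = 0 := by
        by_contra h'
        exact h (support_deriv_subset h')
      simp [f, z1, z2]
  obtain ⟨hI, hfub⟩ := setIntegral_semiCylinder hω hH hf
  have hi2 : Integrable (fun ζ => χ ζ ^ 2) :=
    (hcχ.memLp_of_hasCompactSupport (p := 2) hχc).integrable_sq
  have hi2' : Integrable (fun ζ => deriv χ ζ ^ 2) :=
    (hcχ'.memLp_of_hasCompactSupport (p := 2) hχ'c).integrable_sq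
  have hinner : ∀ η ∈ ω, ∫ ζ in Ioi (-H η), f (WithLp.toLp 2 (η, ζ)) ≤
      (H η + c) * ‖fderiv ℝ v η‖ ^ 2 + (κ - μ * (H η + c)) * v η ^ 2 := by
    intro η hη
    have e : ∀ ζ, f (WithLp.toLp 2 (η, ζ)) = (‖fderiv ℝ v η‖ ^ 2 - μ * v η ^ 2) * χ ζ ^ 2 +
        v η ^ 2 * deriv χ ζ ^ 2 := fun ζ => by
      change (‖fderiv ℝ v η‖ ^ 2 * χ ζ ^ 2 + v η ^ 2 * deriv χ ζ ^ 2) - μ * (v η * χ ζ) ^ 2 = _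
      ring
    simp only [e]
    rw [integral_add (hi2.integrableOn.const_mul _) (hi2'.integrableOn.const_mul _),
      integral_const_mul, integral_const_mul,
      setIntegral_Ioi_sq_of_plateau hcχ hχc hχ1 (hM η (subset_closure hη))]
    have hle : ∫ ζ in Ioi (-H η), deriv χ ζ ^ 2 ≤ κ :=
      (setIntegral_le_integral hi2' (ae_of_all _ fun ζ => by positivity)).trans hκ
    nlinarith [mul_le_mul_of_nonneg_left hle (sq_nonneg (v η))]
  have hHm : AEStronglyMeasurable H (volume.restrict ω) :=
    (hH.mono subset_closure).aestronglyMeasurable hω.measurableSet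
  have hHb : ∀ᵐ η ∂volume.restrict ω, |H η| ≤ M :=
    (ae_restrict_iff' hω.measurableSet).2 (ae_of_all _ fun η hη => hM η (subset_closure hη))
  have k1 : IntegrableOn (fun η => (H η + c) * ‖fderiv ℝ v η‖ ^ 2) ω := by
    refine (hv.integrable_fderiv_sq ω).bdd_mul (hHm.add_const c) (c := M + |c|) ?_
    filter_upwards [hHb] with η hη
    exact (abs_add_le _ _).trans (by linarith)
  have k2 : IntegrableOn (fun η => (κ - μ * (H η + c)) * v η ^ 2) ω := by
    refine (hv.integrable_sq ω).bdd_mul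
      (aestronglyMeasurable_const.sub ((hHm.add_const c).const_mul μ))
      (c := |κ| + |μ| * (M + |c|)) ?_
    filter_upwards [hHb] with η hη
    refine (abs_sub _ _).trans ?_
    rw [abs_mul]
    gcongr
    exact (abs_add_le _ _).trans (by linarith)
  calc (∫ ξ in semiCylinder ω H, ‖fderiv ℝ (fun ξ : CylSpace d => v ξ.fst * χ ξ.snd) ξ‖ ^ 2) -
        μ * ∫ ξ in semiCylinder ω H, (v ξ.fst * χ ξ.snd) ^ 2
      = ∫ ξ in semiCylinder ω H, (‖fderiv ℝ (fun ξ : CylSpace d => v ξ.fst * χ ξ.snd) ξ‖ ^ 2 -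
        μ * (v ξ.fst * χ ξ.snd) ^ 2) := by
        rw [integral_sub (hW.integrable_fderiv_sq _) ((hW.integrable_sq _).const_mul μ),
          integral_const_mul]
    _ ≤ ∫ ξ in semiCylinder ω H, f ξ := by
        refine integral_mono ((hW.integrable_fderiv_sq _).sub ((hW.integrable_sq _).const_mul μ))
          hf.integrableOn fun ξ => ?_
        exact sub_le_sub_right (norm_fderiv_mul_sq_le hv.differentiable
          (hχ.differentiable (by simp)) ξ) _
    _ ≤ ∫ η in ω, ((H η + c) * ‖fderiv ℝ v η‖ ^ 2 + (κ - μ * (H η + c)) * v η ^ 2) := by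
        rw [hfub]
        exact setIntegral_mono_on hI (k1.add k2) hω.measurableSet hinner
    _ = _ := integral_add k1 k2

/-- A trial function with Rayleigh quotient below `μ`. -/
theorem IsEigenpair.exists_trial (hω : IsOpen ω) (hωb : Bornology.IsBounded ω)
    (hH : ContinuousOn H (closure ω)) {μ : ℝ} {φ : EuclideanSpace ℝ (Fin d) → ℝ}
    {g : EuclideanSpace ℝ (Fin d) → EuclideanSpace ℝ (Fin d)}
    (hφ : IsEigenpair ω (frontier ω) μ φ g)
    (hneg : ∫ η in ω, H η * (‖g η‖ ^ 2 - μ * φ η ^ 2) < 0) :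
    ∃ v, IsAdmissible (lateralSide ω H) v ∧
      ∫ ξ in semiCylinder ω H, ‖fderiv ℝ v ξ‖ ^ 2 < μ * ∫ ξ in semiCylinder ω H, v ξ ^ 2 := by
  obtain ⟨M, hM0, hM⟩ := exists_abs_le hωb hH
  set A := ∫ η in ω, φ η ^ 2
  set ν := ∫ η in ω, H η * (‖g η‖ ^ 2 - μ * φ η ^ 2) with hν
  have hA : 0 ≤ A := integral_nonneg fun x => by positivity
  set κ := -ν / (A + 1) with hκdef
  have hκ : 0 < κ := div_pos (by linarith) (by positivity)
  have hJ : ν + κ * A < 0 := by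
    have : κ * (A + 1) = -ν := div_mul_cancel₀ _ (by positivity)
    linarith
  obtain ⟨χ, hχ, hχc, hχ1, hχκ⟩ := exists_cutoff M hκ
  set c := ∫ ζ in Ioi 0, χ ζ ^ 2 with hc
  have hHm : AEStronglyMeasurable H (volume.restrict ω) :=
    (hH.mono subset_closure).aestronglyMeasurable hω.measurableSet
  have hHb : ∀ᵐ η ∂volume.restrict ω, |H η| ≤ M :=
    (ae_restrict_iff' hω.measurableSet).2 (ae_of_all _ fun η hη => hM η (subset_closure hη))
  have hm1 : AEStronglyMeasurable (fun η => H η + c) (volume.restrict ω) := hHm.add_const c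
  have hb1 : ∀ᵐ η ∂volume.restrict ω, |H η + c| ≤ M + |c| := by
    filter_upwards [hHb] with η hη
    exact (abs_add_le _ _).trans (by linarith)
  have hm2 : AEStronglyMeasurable (fun η => κ - μ * (H η + c)) (volume.restrict ω) :=
    aestronglyMeasurable_const.sub (hm1.const_mul μ)
  have hb2 : ∀ᵐ η ∂volume.restrict ω, |κ - μ * (H η + c)| ≤ |κ| + |μ| * (M + |c|) := by
    filter_upwards [hb1] with η hη
    refine (abs_sub _ _).trans ?_
    rw [abs_mul]
    gcongr
  have hφ2 : IntegrableOn (fun η => φ η ^ 2) ω := hφ.mem.memLp_fun.integrable_sq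
  have hg2 : IntegrableOn (fun η => ‖g η‖ ^ 2) ω :=
    hφ.mem.memLp_grad.integrable_norm_pow (p := 2) (by norm_num)
  -- the constant `c` drops out at the eigenfunction, as `∫ (|∇φ|² - μ φ²) = 0`
  have hlim : (∫ η in ω, (H η + c) * ‖g η‖ ^ 2) + ∫ η in ω, (κ - μ * (H η + c)) * φ η ^ 2 =
      ν + κ * A := by
    have i1 : IntegrableOn (fun η => (H η + c) * ‖g η‖ ^ 2) ω := hg2.bdd_mul hm1 hb1
    have i2 : IntegrableOn (fun η => (κ - μ * (H η + c)) * φ η ^ 2) ω := hφ2.bdd_mul hm2 hb2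
    have i3 : IntegrableOn (fun η => ‖g η‖ ^ 2 - μ * φ η ^ 2) ω := hg2.sub (hφ2.const_mul μ)
    have i4 : IntegrableOn (fun η => H η * (‖g η‖ ^ 2 - μ * φ η ^ 2)) ω := i3.bdd_mul hHm hHb
    have i5 : IntegrableOn (fun η => c * (‖g η‖ ^ 2 - μ * φ η ^ 2)) ω := i3.const_mul c
    have i6 : IntegrableOn (fun η => H η * (‖g η‖ ^ 2 - μ * φ η ^ 2) +
        c * (‖g η‖ ^ 2 - μ * φ η ^ 2)) ω := i4.add i5
    have hz : ∫ η in ω, (‖g η‖ ^ 2 - μ * φ η ^ 2) = 0 := by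
      rw [integral_sub hg2 (hφ2.const_mul μ), integral_const_mul, hφ.integral_norm_sq, sub_self]
    have e : (fun η => (H η + c) * ‖g η‖ ^ 2 + (κ - μ * (H η + c)) * φ η ^ 2) =
        fun η => H η * (‖g η‖ ^ 2 - μ * φ η ^ 2) + c * (‖g η‖ ^ 2 - μ * φ η ^ 2) +
          κ * φ η ^ 2 := by ext η; ring
    rw [← integral_add i1 i2, e, integral_add i6 (hφ2.const_mul κ), integral_add i4 i5,
      integral_const_mul, integral_const_mul, hz, mul_zero, add_zero]
  have hε : 0 < -(ν + κ * A) / 3 := by linarith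
  obtain ⟨δ₁, hδ₁, h₁⟩ := exists_eLpNorm_sub_le_imp hφ.mem.memLp_grad hm1 (by positivity) hb1 hε
  obtain ⟨δ₂, hδ₂, h₂⟩ := exists_eLpNorm_sub_le_imp hφ.mem.memLp_fun hm2 (by positivity) hb2 hε
  obtain ⟨v, hv1, hv2, hv3, a1, a2⟩ := hφ.mem.approx (min δ₁ δ₂) (lt_min hδ₁ hδ₂)
  have hv : IsAdmissible (frontier ω) v := ⟨hv1, hv2, hv3⟩
  have b1 := h₁ _ (hv.memLp_gradient ω) (a2.trans (min_le_left _ _))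
  have b2 := h₂ _ (hv.memLp ω) (a1.trans (min_le_right _ _))
  simp only [norm_gradient] at b1
  simp only [Real.norm_eq_abs, sq_abs] at b2
  refine ⟨_, hv.mul_cutoff hω hH hχ hχc, ?_⟩
  have hR := hv.rayleigh_mul_cutoff_le hω hH hM hχ hχc hχ1 hχκ μ
  rw [← hc] at hR
  have c1 := (abs_le.1 b1).2
  have c2 := (abs_le.1 b2).2
  linarith

end TrialFunctionCylinder

end MixedBVP

theorem theorem3p1 (d : ℕ) (hd : 1 ≤ d) (ω : Set (EuclideanSpace ℝ (Fin d)))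
    (hω_open : IsOpen ω) (hω_conn : IsConnected ω) (hω_bdd : Bornology.IsBounded ω)
    (H : EuclideanSpace ℝ (Fin d) → ℝ) (hH : ContinuousOn H (closure ω))
    (μ₁ : ℝ) (φ₁ : EuclideanSpace ℝ (Fin d) → ℝ)
    (gradφ₁ : EuclideanSpace ℝ (Fin d) → EuclideanSpace ℝ (Fin d))
    (hφ₁ : MixedBVP.IsFirstDirichletEigenpair ω μ₁ φ₁ gradφ₁)
    (hneg : ∫ η in ω, H η * (‖gradφ₁ η‖ ^ 2 - μ₁ * φ₁ η ^ 2) < 0) :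
    ∃ Λ : ℝ, 0 < Λ ∧ Λ < μ₁ ∧
      MixedBVP.IsEigenvalue (MixedBVP.semiCylinder ω H) (MixedBVP.lateralSide ω H) Λ := by
  have hμ₁ : 0 < μ₁ := hφ₁.eigenpair.pos_of_integral_neg hneg
  have hray : ∀ w, MixedBVP.IsAdmissible (frontier ω) w →
      μ₁ * ∫ x in ω, w x ^ 2 ≤ ∫ x in ω, ‖fderiv ℝ w x‖ ^ 2 := fun w hw =>
    hφ₁.rayleigh hω_open hω_bdd hw
  obtain ⟨c, hc, hpoinc⟩ := MixedBVP.exists_poincare_const hω_open hω_bdd hH hμ₁ hray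
  obtain ⟨Λ, hΛ, hev, hmax⟩ := MixedBVP.exists_isEigenvalue_lt μ₁
    (hφ₁.eigenpair.exists_trial hω_open hω_bdd hH hneg)
    (fun m hm => MixedBVP.exists_finite_rank_bound_semiCylinder hω_open hω_bdd hH hμ₁ hray hm)
  exact ⟨Λ, hc.trans_le (hmax c hpoinc), hΛ, hev⟩
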